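/- Let $\lambda>0$, $d>0$ and $Z_0\in\mathbb R$, and let ${\rm j}$ denote the imaginary unit. Let $$g(x)=\frac{-{\rm j}Z_0\,e^{{\rm j}2\pi\sqrt{x^2+d^2}/\lambda}}{2\lambda\sqrt{x^2+d^2}}\left[\frac{d^2}{x^2+d^2}+\frac{{\rm j}}{2\pi\sqrt{x^2+d^2}/\lambda}\,\frac{d^2-2x^2}{x^2+d^2}-\frac{1}{(2\pi/\lambda)^2(x^2+d^2)}\,\frac{d^2-2x^2}{x^2+d^2}\right],\qquad x\in\mathbb R,$$ be the $xx$-component of the dyadic Green function between two parallel lines at distance $d$ (with $x$ the longitudinal offset, $\lambda$ the wavelength and $Z_0$ the free-space impedance). Then $g$ is integrable on $\mathbb R$, and its Fourier transform $$G(\kappa)=\frac{1}{\sqrt{2\pi}}\int_{-\infty}^{\infty}g(x)e^{-{\rm j}\kappa x}\,{\rm d}x$$ satisfies, for every $\kappa\in\mathbb R$, $$G(\kappa)=(F_1*F_2)(\kappa)=\int_{-\infty}^{\infty}F_1(q)F_2(\kappa-q)\,{\rm d}q,$$ the integral being absolutely convergent, where, with $m=\sqrt{|(2\pi/\lambda)^2-\kappa^2|}$,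 $$F_1(\kappa)=\frac{-{\rm j}Z_0}{2\pi\lambda}\begin{cases}\frac{\pi}{2}{\rm j}J_0(dm)-\frac{\pi}{2}Y_0(dm), & |\kappa|<\frac{2\pi}{\lambda},\\ K_0(dm), & |\kappa|>\frac{2\pi}{\lambda},\end{cases}$$ and $$\begin{aligned}F_2(\kappa)=\;&d\sqrt{\tfrac{\pi}{2}}\,e^{-d|\kappa|}+\frac{{\rm j}d\lambda}{2\pi}\sqrt{\tfrac{2}{\pi}}\,|\kappa|K_1(d|\kappa|)-\frac{{\rm j}\lambda}{\pi}\Big[\sqrt{\tfrac{2}{\pi}}K_0(d|\kappa|)-d\sqrt{\tfrac{2}{\pi}}\,|\kappa|K_1(d|\kappa|)\Big]\\&-\Big(\frac{\lambda}{2\pi}\Big)^2\frac{1}{2d}\sqrt{\tfrac{\pi}{2}}\,(1+|d\kappa|)e^{-|d\kappa|}+\Big(\frac{\lambda}{2\pi}\Big)^2\Big[\sqrt{\tfrac{\pi}{2}}\,\frac{2e^{-d|\kappa|}}{d}-\frac1d\sqrt{\tfrac{\pi}{2}}\,(1+|d\kappa|)e^{-|d\kappa|}\Big]\end{aligned}$$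 for $\kappa\neq0$ (the values of $F_1$ at $|\kappa|=2\pi/\lambda$ and of $F_2$ at $\kappa=0$ are immaterial). Here $J_0$ is the Bessel function of the first kind, $Y_0$ the Neumann function, and $K_0,K_1$ the modified Bessel functions of the second kind. -/

import Mathlib

open MeasureTheory

noncomputable section

namespace ParallelLines

/-- The Bessel function of the first kind of order zero (Bessel's integral):
`J₀(x) = (1/π) ∫₀^π cos (x sin θ) dθ`. -/
def besselJ0 (x : ℝ) : ℝ :=
  (1 / Real.pi) * ∫ θ in (0 : ℝ)..Real.pi, Real.cos (x * Real.sin θ)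

/-- The Neumann function (Bessel function of the second kind) of order zero, for `x > 0`
(Schläfli's integral):
`Y₀(x) = (1/π) ∫₀^π sin (x sin θ) dθ - (2/π) ∫₀^∞ exp (-x sinh t) dt`. -/
def besselY0 (x : ℝ) : ℝ :=
  (1 / Real.pi) * (∫ θ in (0 : ℝ)..Real.pi, Real.sin (x * Real.sin θ))
    - (2 / Real.pi) * ∫ t in Set.Ioi (0 : ℝ), Real.exp (-x * Real.sinh t)

/-- The modified Bessel function of the second kind (Bessel function with imaginary argument)
of order `ν`, for `x > 0`: `K_ν(x) = ∫₀^∞ exp (-x cosh t) cosh (ν t) dt`. -/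
def besselK (ν x : ℝ) : ℝ :=
  ∫ t in Set.Ioi (0 : ℝ), Real.exp (-x * Real.cosh t) * Real.cosh (ν * t)

/-- The `xx`-component of the dyadic Green function between two parallel lines at distance `d`,
at wavelength `lam`, as a function of the longitudinal offset `x = r - s`. -/
def green (Z₀ lam d x : ℝ) : ℂ :=
  (-Complex.I * Z₀ * Complex.exp (Complex.I * (2 * Real.pi * √(x ^ 2 + d ^ 2) / lam : ℝ)))
      / (2 * lam * √(x ^ 2 + d ^ 2) : ℝ)
    * (((d ^ 2 / (x ^ 2 + d ^ 2) : ℝ) : ℂ)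
      + Complex.I / (2 * Real.pi * √(x ^ 2 + d ^ 2) / lam : ℝ)
          * ((d ^ 2 - 2 * x ^ 2) / (x ^ 2 + d ^ 2) : ℝ)
      - 1 / ((2 * Real.pi / lam) ^ 2 * (x ^ 2 + d ^ 2) : ℝ)
          * ((d ^ 2 - 2 * x ^ 2) / (x ^ 2 + d ^ 2) : ℝ))

/-- The unitary Fourier transform `(1/√(2π)) ∫ f(x) exp (-j κ x) dx`. -/
def fourierU (f : ℝ → ℂ) (κ : ℝ) : ℂ :=
  ((1 / √(2 * Real.pi) : ℝ) : ℂ) * ∫ x : ℝ, f x * Complex.exp (-Complex.I * (κ * x : ℝ))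

/-- `m = √|(2π/lam)² - κ²|`. -/
def transverse (lam κ : ℝ) : ℝ := √|(2 * Real.pi / lam) ^ 2 - κ ^ 2|

/-- The first factor of the convolution. Its value at `|κ| = 2π/lam` is irrelevant. -/
def F1 (Z₀ lam d κ : ℝ) : ℂ :=
  -Complex.I * Z₀ / (2 * Real.pi * lam : ℝ) *
    (if |κ| < 2 * Real.pi / lam then
      ((Real.pi / 2 : ℝ) : ℂ) * Complex.I * (besselJ0 (d * transverse lam κ) : ℝ)
        - (Real.pi / 2 * besselY0 (d * transverse lam κ) : ℝ)
    else
      ((besselK 0 (d * transverse lam κ) : ℝ) : ℂ))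

/-- The second factor of the convolution. Its value at `κ = 0` is irrelevant. -/
def F2 (lam d κ : ℝ) : ℂ :=
  ((d * √(Real.pi / 2) * Real.exp (-d * |κ|) : ℝ) : ℂ)
    + Complex.I * (d * lam / (2 * Real.pi) * √(2 / Real.pi) * |κ| * besselK 1 (d * |κ|) : ℝ)
    - Complex.I * (lam / Real.pi * (√(2 / Real.pi) * besselK 0 (d * |κ|)
        - d * √(2 / Real.pi) * |κ| * besselK 1 (d * |κ|)) : ℝ)
    - ((lam / (2 * Real.pi)) ^ 2 * (1 / (2 * d)) * √(Real.pi / 2) * (1 + |d * κ|)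
        * Real.exp (-|d * κ|) : ℝ)
    + ((lam / (2 * Real.pi)) ^ 2 * (√(Real.pi / 2) * (2 * Real.exp (-d * |κ|) / d)
        - 1 / d * √(Real.pi / 2) * (1 + |d * κ|) * Real.exp (-|d * κ|)) : ℝ)

end ParallelLines

end

noncomputable section

namespace ParallelLines

open Filter Topology

/-! With `r = √(x² + d²)` and `k = 2π/λ`, the Green function is a constant times the spherical wave
`exp(jkr)/r` times a bracket of size `O(1/r)`. The claim is the product-to-convolution rule: `F2` is
the transform of the bracket and `F1`, up to constants, that of the wave. The wave is not
integrable, so its transform is only a conditional limit and the rule needs a regularisation.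

Bracket: `F2` is integrable, and `inverse_transform_F2` recovers the bracket from explicit
transforms of `e^{-d|q|}`, `|q|e^{-d|q|}`, `K₀(d|q|)` and `|q|K₁(d|q|)`; the Bessel cases follow
from the exponential ones by Fubini.

Wave: cut off at `|x| ≤ d sinh T`. The substitution `x = d sinh t` and a hyperbolic rotation turn
the phase into `dm cosh` for `|q| < k` and `dm sinh` for `q > k`. Shifting the contour by `iπ/2`
replaces oscillation by decay; this yields the limit in terms of `J₀, Y₀, K₀` (`tendsto_truncWave`)
and a bound uniform in `T` with integrable singularities at `±k` (`exists_norm_truncWave_le`).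

For finite `T` Fubini gives the convolution identity (`truncated_transform_eq`), and dominated
convergence lets `T → ∞` (`integral_green_mul_exp`). -/

/-! ### Bounds for the Bessel integrals -/

lemma exp_neg_le_rpow {u : ℝ} (hu : 0 < u) : Real.exp (-u) ≤ u ^ (-(1 / 4) : ℝ) := by
  rw [Real.rpow_def_of_pos hu]
  apply Real.exp_le_exp.2
  have h1 := Real.log_le_sub_one_of_pos hu
  by_cases h : 1 ≤ u
  · linarith
  · have h2 : Real.log u ≤ 0 := Real.log_nonpos hu.le (by linarith)
    linarith

lemma exp_half_le_cosh (t : ℝ) : Real.exp t / 2 ≤ Real.cosh t := by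
  rw [Real.cosh_eq]
  have := Real.exp_pos (-t)
  linarith

lemma cosh_sub_one_le_sinh {t : ℝ} (ht : 0 ≤ t) : Real.cosh t - 1 ≤ Real.sinh t := by
  have h : Real.cosh t - Real.sinh t = Real.exp (-t) := Real.cosh_sub_sinh t
  have : Real.exp (-t) ≤ 1 := Real.exp_le_one_iff.2 (by linarith)
  linarith

lemma exp_neg_mul_cosh_le {y : ℝ} (hy : 0 < y) (t : ℝ) :
    Real.exp (-y * Real.cosh t) ≤ (y / 2) ^ (-(1 / 4) : ℝ) * Real.exp (-(1 / 4) * t) := by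
  have h1 : Real.exp (-y * Real.cosh t) ≤ Real.exp (-(y / 2 * Real.exp t)) := by
    apply Real.exp_le_exp.2
    nlinarith [exp_half_le_cosh t]
  refine h1.trans ((exp_neg_le_rpow (by positivity)).trans_eq ?_)
  rw [Real.mul_rpow (by positivity) (by positivity), ← Real.exp_mul]
  ring_nf

lemma integrable_exp_neg_mul_cosh {y : ℝ} (hy : 0 < y) :
    IntegrableOn (fun t => Real.exp (-y * Real.cosh t)) (Set.Ioi 0) := by
  refine Integrable.mono' ((integrableOn_exp_mul_Ioi (by norm_num : -(1 / 4 : ℝ) < 0) 0).const_mul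
    ((y / 2) ^ (-(1 / 4) : ℝ))) (by fun_prop) (Filter.Eventually.of_forall fun t => ?_)
  rw [Real.norm_of_nonneg (Real.exp_pos _).le]
  exact exp_neg_mul_cosh_le hy t

lemma besselK_zero_eq (y : ℝ) : besselK 0 y = ∫ t in Set.Ioi (0 : ℝ), Real.exp (-y * Real.cosh t) := by
  simp [besselK]

lemma besselK_zero_nonneg (y : ℝ) : 0 ≤ besselK 0 y := by
  rw [besselK_zero_eq]
  exact integral_nonneg fun t => (Real.exp_pos _).le

/-- The singularity at `0` is only logarithmic, but a power is easier to handle. With exponent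
`-1/4`, a product of two such singularities at the same point is still locally integrable. -/
lemma besselK_zero_le {y : ℝ} (hy : 0 < y) : besselK 0 y ≤ 4 * (y / 2) ^ (-(1 / 4) : ℝ) := by
  rw [besselK_zero_eq]
  refine (integral_mono (integrable_exp_neg_mul_cosh hy)
    ((integrableOn_exp_mul_Ioi (by norm_num : -(1 / 4 : ℝ) < 0) 0).const_mul
    ((y / 2) ^ (-(1 / 4) : ℝ))) (exp_neg_mul_cosh_le hy)).trans_eq ?_
  rw [integral_const_mul, integral_exp_mul_Ioi (by norm_num : -(1 / 4 : ℝ) < 0)]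
  norm_num
  ring

/-- Since `cosh ≥ 1`, half of the exponent can be split off; this supplies the exponential decay
missing from the power bound. -/
lemma besselK_zero_le_exp_mul {y : ℝ} (hy : 0 < y) :
    besselK 0 y ≤ Real.exp (-(y / 2)) * besselK 0 (y / 2) := by
  rw [besselK_zero_eq, besselK_zero_eq, ← integral_const_mul]
  refine integral_mono (integrable_exp_neg_mul_cosh hy)
    ((integrable_exp_neg_mul_cosh (half_pos hy)).const_mul _) fun t => ?_
  simp only
  rw [← Real.exp_add]
  apply Real.exp_le_exp.2
  nlinarith [Real.one_le_cosh t]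

lemma exp_neg_mul_cosh_mul_cosh_le {y : ℝ} (hy : 0 < y) (t : ℝ) :
    Real.exp (-y * Real.cosh t) * Real.cosh t ≤ 2 / y * Real.exp (-(y / 2) * Real.cosh t) := by
  set v := y / 2 * Real.cosh t with hv
  have h1 : v ≤ Real.exp v := by linarith [Real.add_one_le_exp v]
  have h2 : Real.exp (-y * Real.cosh t) = Real.exp (-v) * Real.exp (-v) := by
    rw [← Real.exp_add]; congr 1; rw [hv]; ring
  have h3 : Real.exp (-(y / 2) * Real.cosh t) = Real.exp (-v) := by rw [hv]; congr 1; ring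
  have h4 : Real.cosh t = 2 / y * v := by rw [hv]; field_simp
  rw [h2, h3, h4]
  have h5 : Real.exp (-v) * v ≤ 1 := by
    rw [Real.exp_neg, inv_mul_le_iff₀ (Real.exp_pos v)]; linarith
  have h6 : 0 < 2 / y * Real.exp (-v) := by positivity
  nlinarith

lemma besselK_one_nonneg (y : ℝ) : 0 ≤ besselK 1 y :=
  integral_nonneg fun _ => mul_nonneg (Real.exp_pos _).le (Real.cosh_pos _).le

/-- The weight `cosh t` is absorbed by half of the exponent through `v e^{-v} ≤ 1`. The resulting
`1/y` is cancelled by the factor `|κ|` that accompanies `K₁` in `F2`. -/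
lemma besselK_one_le {y : ℝ} (hy : 0 < y) : besselK 1 y ≤ 2 / y * besselK 0 (y / 2) := by
  rw [besselK_zero_eq, besselK, ← integral_const_mul]
  have hi := (integrable_exp_neg_mul_cosh (half_pos hy)).const_mul (2 / y)
  refine integral_mono (Integrable.mono' hi (by fun_prop) (Filter.Eventually.of_forall fun t => ?_))
    hi fun t => ?_
  · rw [Real.norm_of_nonneg (mul_nonneg (Real.exp_pos _).le (Real.cosh_pos _).le), one_mul]
    exact exp_neg_mul_cosh_mul_cosh_le hy t
  · simp only [one_mul]
    exact exp_neg_mul_cosh_mul_cosh_le hy t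

/-- The price `e^y` is harmless: the bound serves only for `|q| < k`, where `y ≤ dk`. -/
lemma exp_neg_mul_sinh_le {y t : ℝ} (hy : 0 < y) (ht : 0 ≤ t) :
    Real.exp (-y * Real.sinh t) ≤ Real.exp y * Real.exp (-y * Real.cosh t) := by
  rw [← Real.exp_add]
  apply Real.exp_le_exp.2
  nlinarith [cosh_sub_one_le_sinh ht]

lemma integrable_exp_neg_mul_sinh {y : ℝ} (hy : 0 < y) :
    IntegrableOn (fun t => Real.exp (-y * Real.sinh t)) (Set.Ioi 0) := by
  refine Integrable.mono' ((integrable_exp_neg_mul_cosh hy).const_mul (Real.exp y)) (by fun_prop)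
    ((ae_restrict_iff' measurableSet_Ioi).2 (Filter.Eventually.of_forall fun t ht => ?_))
  rw [Real.norm_of_nonneg (Real.exp_pos _).le]
  exact exp_neg_mul_sinh_le hy (le_of_lt ht)

lemma integral_exp_neg_mul_sinh_le {y : ℝ} (hy : 0 < y) :
    ∫ t in Set.Ioi (0 : ℝ), Real.exp (-y * Real.sinh t) ≤ Real.exp y * besselK 0 y := by
  rw [besselK_zero_eq, ← integral_const_mul]
  exact setIntegral_mono_on (integrable_exp_neg_mul_sinh hy)
    ((integrable_exp_neg_mul_cosh hy).const_mul _) measurableSet_Ioi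
    fun t ht => exp_neg_mul_sinh_le hy (le_of_lt ht)

/-- Within distance `1` of `a` the exponential is at most `1` and the power is integrable; elsewhere
the power is at most `1` and the exponential is integrable. -/
lemma integrable_abs_rpow_mul_exp {s c : ℝ} (hs : s < 1) (hs0 : 0 ≤ s) (hc : 0 < c) (a b : ℝ) :
    Integrable fun q : ℝ => |q - a| ^ (-s) * Real.exp (-c * |b - q|) := by
  have he : Integrable fun q : ℝ => Real.exp (-c * |b - q|) := by
    have : Integrable fun q : ℝ => Real.exp (-c * |q|) := by
      rw [← integrableOn_univ, ← Set.Iic_union_Ioi (a := (0 : ℝ))]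
      refine IntegrableOn.union ?_ ?_
      · refine (integrableOn_exp_mul_Iic hc 0).congr_fun (fun q hq => ?_) measurableSet_Iic
        simp [abs_of_nonpos (Set.mem_Iic.1 hq)]
      · refine (integrableOn_exp_mul_Ioi (neg_neg_of_pos hc) 0).congr_fun (fun q hq => ?_)
          measurableSet_Ioi
        simp [abs_of_pos (Set.mem_Ioi.1 hq)]
    exact this.comp_sub_left b
  have hr : Integrable (fun q : ℝ => (Set.Icc (a - 1) (a + 1)).indicator
      (fun q => |q - a| ^ (-s)) q) := by
    rw [integrable_indicator_iff measurableSet_Icc]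
    have h0 : IntegrableOn (fun q : ℝ => |q| ^ (-s)) (Set.Icc (-1) 1) := by
      have h := intervalIntegral.intervalIntegrable_rpow' (a := 0) (b := 1) (r := -s) (by linarith)
      have hI : IntervalIntegrable (fun q : ℝ => |q| ^ (-s)) volume 0 1 := by
        refine h.congr fun q hq => ?_
        rw [Set.uIoc_of_le zero_le_one] at hq
        simp [abs_of_pos hq.1]
      have hI' : IntervalIntegrable (fun q : ℝ => |q| ^ (-s)) volume (-1) 0 := by
        have := hI.comp_sub_left 0
        simp only [zero_sub, abs_neg, sub_zero] at this
        exact this.symm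
      exact (intervalIntegrable_iff_integrableOn_Icc_of_le (by norm_num)).1 (hI'.trans hI)
    have h1 := (integrable_indicator_iff measurableSet_Icc).2 h0
    have h2 := h1.comp_sub_right a
    refine (integrable_indicator_iff measurableSet_Icc).1 (h2.congr
      (Filter.Eventually.of_forall fun q => ?_))
    simp only [Set.indicator, Set.mem_Icc]
    congr 1
    apply propext
    constructor <;> rintro ⟨h, h'⟩ <;> constructor <;> linarith
  refine Integrable.mono' (he.add hr) ?_ (Filter.Eventually.of_forall fun q => ?_)
  · exact ((measurable_id.sub_const a).abs.pow_const _ |>.mul (by fun_prop)).aestronglyMeasurable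
  · rw [Real.norm_of_nonneg (by positivity)]
    have hE : Real.exp (-c * |b - q|) ≤ 1 := Real.exp_le_one_iff.2 (by nlinarith [abs_nonneg (b - q)])
    have hE0 := Real.exp_pos (-c * |b - q|)
    have hp : 0 ≤ |q - a| ^ (-s) := by positivity
    simp only [Pi.add_apply, Set.indicator]
    split_ifs with h
    · nlinarith
    · have : |q - a| ^ (-s) ≤ 1 := by
        apply Real.rpow_le_one_of_one_le_of_nonpos _ (by linarith)
        by_contra hlt
        rw [not_le, abs_lt] at hlt
        exact h ⟨by linarith, by linarith⟩
      nlinarith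

/-! ### Contour shift by `iπ/2` -/

/-- The integral over a vertical side of length `π / 2`, at abscissa `b`. -/
def verticalSide (f : ℂ → ℂ) (b : ℝ) : ℂ :=
  Complex.I * ∫ s in (0 : ℝ)..(Real.pi / 2), f (b + s * Complex.I)

/-- Cauchy's theorem on the rectangle `[0, b] × [0, π/2]`. -/
lemma integral_shift_eq {f : ℂ → ℂ} (hf : Differentiable ℂ f) (b : ℝ) :
    ∫ u in (0 : ℝ)..b, f u = verticalSide f 0
      + (∫ u in (0 : ℝ)..b, f (u + (Real.pi / 2 : ℝ) * Complex.I)) - verticalSide f b := by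
  have h := Complex.integral_boundary_rect_eq_zero_of_differentiableOn f 0
    (b + (Real.pi / 2 : ℝ) * Complex.I) hf.differentiableOn
  simp only [Complex.zero_re, Complex.zero_im, Complex.add_re, Complex.add_im, Complex.ofReal_re,
    Complex.ofReal_im, Complex.mul_re, Complex.mul_im, Complex.I_re, Complex.I_im, mul_zero,
    mul_one, zero_mul, sub_zero, add_zero, zero_add, Complex.ofReal_zero, smul_eq_mul] at h
  simp only [verticalSide, Complex.ofReal_zero, zero_add]
  linear_combination h

/-- This crude bound holds for every `c ≥ 0` and feeds the domination; the next one decays in `c`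
and feeds the limit. -/
lemma norm_verticalSide_le {f : ℂ → ℂ} {b c : ℝ} (hc : 0 ≤ c)
    (hf : ∀ s : ℝ, ‖f (b + s * Complex.I)‖ = Real.exp (-(c * Real.sin s))) :
    ‖verticalSide f b‖ ≤ Real.pi / 2 := by
  rw [verticalSide, norm_mul, Complex.norm_I, one_mul]
  have h := intervalIntegral.norm_integral_le_of_norm_le_const (a := 0) (b := Real.pi / 2) (C := 1)
    (f := fun s : ℝ => f (b + s * Complex.I)) (fun s hs => ?_)
  · rwa [one_mul, sub_zero, abs_of_pos (by positivity)] at h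
  · rw [Set.uIoc_of_le (by positivity)] at hs
    rw [hf]
    have := Real.sin_nonneg_of_nonneg_of_le_pi hs.1.le (by linarith [hs.2, Real.pi_pos])
    exact Real.exp_le_one_iff.2 (by nlinarith)

lemma norm_verticalSide_le_div {f : ℂ → ℂ} {b c : ℝ} (hc : 0 < c)
    (hf : ∀ s : ℝ, ‖f (b + s * Complex.I)‖ = Real.exp (-(c * Real.sin s))) :
    ‖verticalSide f b‖ ≤ Real.pi / (2 * c) := by
  rw [verticalSide, norm_mul, Complex.norm_I, one_mul]
  have hk : -(c * (2 / Real.pi)) ≠ 0 := by have := Real.pi_pos; apply ne_of_lt; rw [neg_lt_zero]; positivity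
  calc ‖∫ s in (0 : ℝ)..(Real.pi / 2), f (b + s * Complex.I)‖
      ≤ ∫ s in (0 : ℝ)..(Real.pi / 2), Real.exp (-(c * (2 / Real.pi)) * s) := by
        refine intervalIntegral.norm_integral_le_of_norm_le (by positivity)
          (Eventually.of_forall fun s hs => ?_) (by apply Continuous.intervalIntegrable; fun_prop)
        rw [hf]
        apply Real.exp_le_exp.2
        -- Jordan's inequality `sin s ≥ 2s/π` on `[0, π/2]`.
        have := Real.mul_le_sin hs.1.le hs.2
        nlinarith
    _ = (c * (2 / Real.pi))⁻¹ * (1 - Real.exp (-(c * (2 / Real.pi)) * (Real.pi / 2))) := by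
        rw [intervalIntegral.integral_comp_mul_left (fun x => Real.exp x) hk, integral_exp]
        simp
        ring
    _ ≤ (c * (2 / Real.pi))⁻¹ * 1 := by
        have := Real.exp_pos (-(c * (2 / Real.pi)) * (Real.pi / 2))
        have := Real.pi_pos
        gcongr
        linarith
    _ = Real.pi / (2 * c) := by
        field_simp

lemma tendsto_verticalSide {f : ℂ → ℂ} {c : ℝ → ℝ} (hc : Tendsto c atTop atTop)
    (hf : ∀ b s : ℝ, ‖f (b + s * Complex.I)‖ = Real.exp (-(c b * Real.sin s))) :
    Tendsto (verticalSide f) atTop (𝓝 0) := by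
  refine squeeze_zero_norm' (a := fun b => Real.pi / 2 / c b) ?_ (hc.const_div_atTop _)
  filter_upwards [hc.eventually_gt_atTop 0] with b hb
  refine (norm_verticalSide_le_div hb (hf b)).trans_eq ?_
  field_simp

lemma norm_integral_ofReal_le {h : ℝ → ℝ} (hi : IntegrableOn h (Set.Ioi 0)) (h0 : ∀ t, 0 ≤ h t)
    {b : ℝ} (hb : 0 ≤ b) :
    ‖∫ u in (0 : ℝ)..b, (h u : ℂ)‖ ≤ ∫ u in Set.Ioi (0 : ℝ), h u := by
  rw [intervalIntegral.integral_ofReal, Complex.norm_real, intervalIntegral.integral_of_le hb,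
    Real.norm_of_nonneg (integral_nonneg h0)]
  exact setIntegral_mono_set hi (Eventually.of_forall h0) (Set.Ioc_subset_Ioi_self.eventuallyLE)

lemma tendsto_integral_ofReal {h : ℝ → ℝ} (hi : IntegrableOn h (Set.Ioi 0)) :
    Tendsto (fun b : ℝ => ∫ u in (0 : ℝ)..b, (h u : ℂ)) atTop
      (𝓝 ((∫ u in Set.Ioi (0 : ℝ), h u : ℝ) : ℂ)) := by
  simp only [intervalIntegral.integral_ofReal]
  exact (Complex.continuous_ofReal.tendsto _).comp
    (intervalIntegral_tendsto_integral_Ioi 0 hi tendsto_id)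

/-! ### The waves `exp(iy cosh z)` and `exp(iy sinh z)` -/

def coshWave (y : ℝ) (z : ℂ) : ℂ := Complex.exp (Complex.I * (y * Complex.cosh z))

def sinhWave (y : ℝ) (z : ℂ) : ℂ := Complex.exp (Complex.I * (y * Complex.sinh z))

lemma differentiable_coshWave (y : ℝ) : Differentiable ℂ (coshWave y) := by
  unfold coshWave; fun_prop

lemma differentiable_sinhWave (y : ℝ) : Differentiable ℂ (sinhWave y) := by
  unfold sinhWave; fun_prop

lemma norm_coshWave (y b s : ℝ) :
    ‖coshWave y (b + s * Complex.I)‖ = Real.exp (-(y * Real.sinh b * Real.sin s)) := by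
  rw [coshWave, Complex.norm_exp, Complex.cosh_add, Complex.cosh_mul_I, Complex.sinh_mul_I,
    ← Complex.ofReal_cosh, ← Complex.ofReal_sinh, ← Complex.ofReal_cos, ← Complex.ofReal_sin]
  congr 1
  simp only [Complex.mul_re, Complex.mul_im, Complex.add_re, Complex.add_im, Complex.I_re,
    Complex.I_im, Complex.ofReal_re, Complex.ofReal_im]
  ring

lemma norm_sinhWave (y b s : ℝ) :
    ‖sinhWave y (b + s * Complex.I)‖ = Real.exp (-(y * Real.cosh b * Real.sin s)) := by
  rw [sinhWave, Complex.norm_exp, Complex.sinh_add, Complex.cosh_mul_I, Complex.sinh_mul_I,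
    ← Complex.ofReal_cosh, ← Complex.ofReal_sinh, ← Complex.ofReal_cos, ← Complex.ofReal_sin]
  congr 1
  simp only [Complex.mul_re, Complex.mul_im, Complex.add_re, Complex.add_im, Complex.I_re,
    Complex.I_im, Complex.ofReal_re, Complex.ofReal_im]
  ring

/-- On the shifted line `cosh` becomes `i sinh`, and in `sinhWave_shift` `sinh` becomes `i cosh`, so
the oscillating integrands turn into the real ones of the Schläfli and `K₀` integrals. -/
lemma coshWave_shift (y u : ℝ) :
    coshWave y (u + (Real.pi / 2 : ℝ) * Complex.I) = (Real.exp (-y * Real.sinh u) : ℝ) := by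
  rw [coshWave, Complex.cosh_add, Complex.cosh_mul_I, Complex.sinh_mul_I, ← Complex.ofReal_cos,
    ← Complex.ofReal_sin, Real.cos_pi_div_two, Real.sin_pi_div_two]
  push_cast
  congr 1
  linear_combination (y * Complex.sinh u) * Complex.I_mul_I

lemma sinhWave_shift (y u : ℝ) :
    sinhWave y (u + (Real.pi / 2 : ℝ) * Complex.I) = (Real.exp (-y * Real.cosh u) : ℝ) := by
  rw [sinhWave, Complex.sinh_add, Complex.cosh_mul_I, Complex.sinh_mul_I, ← Complex.ofReal_cos,
    ← Complex.ofReal_sin, Real.cos_pi_div_two, Real.sin_pi_div_two]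
  push_cast
  congr 1
  linear_combination (y * Complex.cosh u) * Complex.I_mul_I

lemma integral_coshWave_eq (y b : ℝ) :
    ∫ u in (0 : ℝ)..b, coshWave y u = verticalSide (coshWave y) 0
      + (∫ u in (0 : ℝ)..b, ((Real.exp (-y * Real.sinh u) : ℝ) : ℂ))
      - verticalSide (coshWave y) b := by
  simp only [integral_shift_eq (differentiable_coshWave y) b, coshWave_shift]

lemma integral_sinhWave_eq (y b : ℝ) :
    ∫ u in (0 : ℝ)..b, sinhWave y u = verticalSide (sinhWave y) 0
      + (∫ u in (0 : ℝ)..b, ((Real.exp (-y * Real.cosh u) : ℝ) : ℂ))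
      - verticalSide (sinhWave y) b := by
  simp only [integral_shift_eq (differentiable_sinhWave y) b, sinhWave_shift]

lemma norm_integral_coshWave_le {y b : ℝ} (hy : 0 < y) (hb : 0 ≤ b) :
    ‖∫ u in (0 : ℝ)..b, coshWave y u‖
      ≤ Real.pi + ∫ t in Set.Ioi (0 : ℝ), Real.exp (-y * Real.sinh t) := by
  rw [integral_coshWave_eq]
  have h1 := norm_verticalSide_le (f := coshWave y) (b := 0) (c := y * Real.sinh 0) (by simp)
    (norm_coshWave y 0)
  have h2 := norm_verticalSide_le (f := coshWave y) (b := b) (c := y * Real.sinh b)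
    (mul_nonneg hy.le (Real.sinh_nonneg_iff.2 hb)) (norm_coshWave y b)
  have h3 := norm_integral_ofReal_le (integrable_exp_neg_mul_sinh hy)
    (fun t => (Real.exp_pos _).le) hb
  refine (norm_sub_le _ _).trans ?_
  linarith [norm_add_le (verticalSide (coshWave y) (0 : ℝ))
    (∫ u in (0 : ℝ)..b, ((Real.exp (-y * Real.sinh u) : ℝ) : ℂ))]

lemma norm_integral_sinhWave_le {y b : ℝ} (hy : 0 < y) (hb : 0 ≤ b) :
    ‖∫ u in (0 : ℝ)..b, sinhWave y u‖ ≤ Real.pi + besselK 0 y := by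
  rw [integral_sinhWave_eq, besselK_zero_eq]
  have h1 := norm_verticalSide_le (f := sinhWave y) (b := 0) (c := y * Real.cosh 0)
    (by simp [hy.le]) (norm_sinhWave y 0)
  have h2 := norm_verticalSide_le (f := sinhWave y) (b := b) (c := y * Real.cosh b)
    (mul_nonneg hy.le (Real.cosh_pos b).le) (norm_sinhWave y b)
  have h3 := norm_integral_ofReal_le (integrable_exp_neg_mul_cosh hy)
    (fun t => (Real.exp_pos _).le) hb
  refine (norm_sub_le _ _).trans ?_
  linarith [norm_add_le (verticalSide (sinhWave y) (0 : ℝ))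
    (∫ u in (0 : ℝ)..b, ((Real.exp (-y * Real.cosh u) : ℝ) : ℂ))]

lemma tendsto_sinh_atTop : Tendsto Real.sinh atTop atTop := by
  refine tendsto_atTop_mono' atTop ?_ (tendsto_id)
  filter_upwards [eventually_ge_atTop 0] with x hx using Real.self_le_sinh_iff.2 hx

lemma tendsto_cosh_atTop : Tendsto Real.cosh atTop atTop :=
  tendsto_atTop_mono (fun x => (Real.sinh_lt_cosh x).le) tendsto_sinh_atTop

lemma tendsto_integral_coshWave {y : ℝ} (hy : 0 < y) :
    Tendsto (fun b : ℝ => ∫ u in (0 : ℝ)..b, coshWave y u) atTop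
      (𝓝 (verticalSide (coshWave y) 0
        + ((∫ t in Set.Ioi (0 : ℝ), Real.exp (-y * Real.sinh t) : ℝ) : ℂ))) := by
  simp only [integral_coshWave_eq]
  have h := tendsto_verticalSide (tendsto_sinh_atTop.const_mul_atTop hy) (norm_coshWave y)
  simpa using (tendsto_const_nhds.add (tendsto_integral_ofReal (integrable_exp_neg_mul_sinh hy))).sub h

lemma tendsto_integral_sinhWave {y : ℝ} (hy : 0 < y) :
    Tendsto (fun b : ℝ => ∫ u in (0 : ℝ)..b, sinhWave y u) atTop
      (𝓝 (verticalSide (sinhWave y) 0 + (besselK 0 y : ℂ))) := by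
  simp only [integral_sinhWave_eq, besselK_zero_eq]
  have h := tendsto_verticalSide (tendsto_cosh_atTop.const_mul_atTop hy) (norm_sinhWave y)
  simpa using (tendsto_const_nhds.add (tendsto_integral_ofReal (integrable_exp_neg_mul_cosh hy))).sub h

lemma integral_coshWave_neg (y b : ℝ) :
    ∫ u in (0 : ℝ)..(-b), coshWave y u = -∫ u in (0 : ℝ)..b, coshWave y u := by
  have h := intervalIntegral.integral_comp_neg (a := 0) (b := b) (fun u : ℝ => coshWave y u)
  rw [neg_zero] at h
  rw [intervalIntegral.integral_symm, ← h]
  simp [coshWave]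

/-- Because `sinh` is odd, reflecting `u` conjugates the integrand; in the `cosh` case it leaves the
integrand unchanged. -/
lemma integral_sinhWave_neg (y b : ℝ) :
    ∫ u in (0 : ℝ)..(-b), sinhWave y u
      = -(starRingEnd ℂ) (∫ u in (0 : ℝ)..b, sinhWave y u) := by
  have h := intervalIntegral.integral_comp_neg (a := 0) (b := b) (fun u : ℝ => sinhWave y u)
  rw [neg_zero] at h
  rw [intervalIntegral.integral_symm, ← h, ← intervalIntegral.intervalIntegral_conj]
  congr 1
  refine intervalIntegral.integral_congr fun u _ => ?_
  simp only [sinhWave, ← Complex.exp_conj, ← Complex.ofReal_sinh]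
  simp only [map_mul, Complex.conj_I, Complex.conj_ofReal, Real.sinh_neg, Complex.ofReal_neg]
  ring_nf

/-- The side at `0` is `i ∫ exp(iy cos s)` over a quarter period, half of the integral of `exp(iy
sin θ)` over `(0, π)`. Its real and imaginary parts give `J₀` and the first term of `Y₀`; the
shifted line gives the second. The factor `2` counts the two half-lines of integration. -/
lemma verticalSide_coshWave (y : ℝ) :
    2 * (verticalSide (coshWave y) 0
        + ((∫ t in Set.Ioi (0 : ℝ), Real.exp (-y * Real.sinh t) : ℝ) : ℂ))
      = 2 * (((Real.pi / 2 : ℝ) : ℂ) * Complex.I * (besselJ0 y : ℝ)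
        - (Real.pi / 2 * besselY0 y : ℝ)) := by
  have hc : Continuous fun θ : ℝ => Complex.exp (Complex.I * (y * Real.sin θ : ℝ)) := by fun_prop
  have hd : Continuous fun θ : ℝ => Complex.exp (Complex.I * (y * Real.cos θ : ℝ)) := by fun_prop
  have h1 : ∫ θ in (0 : ℝ)..Real.pi, Complex.exp (Complex.I * (y * Real.sin θ : ℝ))
      = ((∫ θ in (0 : ℝ)..Real.pi, Real.cos (y * Real.sin θ) : ℝ) : ℂ)
        + Complex.I * ((∫ θ in (0 : ℝ)..Real.pi, Real.sin (y * Real.sin θ) : ℝ) : ℂ) := by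
    rw [← intervalIntegral.integral_ofReal, ← intervalIntegral.integral_ofReal,
      ← intervalIntegral.integral_const_mul, ← intervalIntegral.integral_add
        (by apply Continuous.intervalIntegrable; fun_prop)
        (by apply Continuous.intervalIntegrable; fun_prop)]
    refine intervalIntegral.integral_congr fun θ _ => ?_
    rw [mul_comm, Complex.exp_mul_I, Complex.ofReal_cos, Complex.ofReal_sin, mul_comm Complex.I]
  have h2 : ∫ θ in (0 : ℝ)..Real.pi, Complex.exp (Complex.I * (y * Real.sin θ : ℝ))
      = 2 * ∫ s in (0 : ℝ)..(Real.pi / 2), Complex.exp (Complex.I * (y * Real.cos s : ℝ)) := by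
    have h3 := intervalIntegral.integral_comp_sub_left (a := -(Real.pi / 2)) (b := Real.pi / 2)
      (fun θ : ℝ => Complex.exp (Complex.I * (y * Real.sin θ : ℝ))) (Real.pi / 2)
    rw [sub_self, sub_neg_eq_add, add_halves] at h3
    rw [← h3]
    simp only [Real.sin_pi_div_two_sub]
    have h4 := intervalIntegral.integral_comp_neg (a := 0) (b := Real.pi / 2)
      (fun θ : ℝ => Complex.exp (Complex.I * (y * Real.cos θ : ℝ)))
    rw [neg_zero] at h4
    simp only [Real.cos_neg] at h4
    rw [← intervalIntegral.integral_add_adjacent_intervals (b := 0)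
      (hd.intervalIntegrable _ _) (hd.intervalIntegrable _ _), ← h4]
    ring
  have h5 : verticalSide (coshWave y) 0
      = Complex.I * ∫ s in (0 : ℝ)..(Real.pi / 2), Complex.exp (Complex.I * (y * Real.cos s : ℝ)) := by
    simp [verticalSide, coshWave, Complex.cosh_mul_I]
  have hpi : (Real.pi : ℂ) ≠ 0 := by exact_mod_cast Real.pi_ne_zero
  rw [h5, besselJ0, besselY0]
  have h6 := h2.symm.trans h1
  generalize (∫ s in (0 : ℝ)..(Real.pi / 2), Complex.exp (Complex.I * (y * Real.cos s : ℝ))) = E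
    at h6 ⊢
  generalize (∫ θ in (0 : ℝ)..Real.pi, Real.cos (y * Real.sin θ)) = C at h6 ⊢
  generalize (∫ θ in (0 : ℝ)..Real.pi, Real.sin (y * Real.sin θ)) = S at h6 ⊢
  generalize (∫ t in Set.Ioi (0 : ℝ), Real.exp (-y * Real.sinh t)) = R
  push_cast
  field_simp
  linear_combination Complex.I * h6 + S * Complex.I_mul_I

/-- The integrand is real on this side, so the side integral is purely imaginary. It therefore
cancels between the two half-lines and only `2K₀` survives. -/
lemma verticalSide_sinhWave_add_conj (y : ℝ) :
    verticalSide (sinhWave y) 0 + (starRingEnd ℂ) (verticalSide (sinhWave y) 0) = 0 := by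
  have h : ∀ s : ℝ, sinhWave y (0 + s * Complex.I) = (Real.exp (-(y * Real.sin s)) : ℝ) := by
    intro s
    rw [sinhWave, zero_add, Complex.sinh_mul_I]
    push_cast
    congr 1
    linear_combination (y * Complex.sin s) * Complex.I_mul_I
  simp only [verticalSide, Complex.ofReal_zero, h, intervalIntegral.integral_ofReal]
  simp

lemma norm_integral_coshWave_le_of_real {y : ℝ} (hy : 0 < y) (b : ℝ) :
    ‖∫ u in (0 : ℝ)..b, coshWave y u‖
      ≤ Real.pi + ∫ t in Set.Ioi (0 : ℝ), Real.exp (-y * Real.sinh t) := by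
  rcases le_total 0 b with hb | hb
  · exact norm_integral_coshWave_le hy hb
  · have h := norm_integral_coshWave_le hy (neg_nonneg.2 hb)
    rwa [integral_coshWave_neg, norm_neg] at h

lemma norm_integral_sinhWave_le_of_real {y : ℝ} (hy : 0 < y) (b : ℝ) :
    ‖∫ u in (0 : ℝ)..b, sinhWave y u‖ ≤ Real.pi + besselK 0 y := by
  rcases le_total 0 b with hb | hb
  · exact norm_integral_sinhWave_le hy hb
  · have h := norm_integral_sinhWave_le hy (neg_nonneg.2 hb)
    rwa [integral_sinhWave_neg, norm_neg, RCLike.norm_conj] at h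

/-! ### The truncated transform of the spherical wave -/

/-- The truncated Fourier transform of `exp (j k r) / r` in the variable `t`, `x = d sinh t`. -/
def truncWave (k d q T : ℝ) : ℂ :=
  ∫ t in (-T)..T, Complex.exp (Complex.I * (d * (k * Real.cosh t - q * Real.sinh t) : ℝ))

lemma truncWave_neg (k d q T : ℝ) : truncWave k d (-q) T = truncWave k d q T := by
  have h := intervalIntegral.integral_comp_neg (a := -T) (b := T)
    (fun t : ℝ => Complex.exp (Complex.I * (d * (k * Real.cosh t - q * Real.sinh t) : ℝ)))
  rw [neg_neg] at h
  rw [truncWave, truncWave, ← h]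
  simp

lemma intervalIntegrable_coshWave (y a b : ℝ) :
    IntervalIntegrable (fun u : ℝ => coshWave y u) volume a b :=
  ((differentiable_coshWave y).continuous.comp Complex.continuous_ofReal).intervalIntegrable _ _

lemma intervalIntegrable_sinhWave (y a b : ℝ) :
    IntervalIntegrable (fun u : ℝ => sinhWave y u) volume a b :=
  ((differentiable_sinhWave y).continuous.comp Complex.continuous_ofReal).intervalIntegrable _ _

/-- Hyperbolic rotation: with `k = m cosh t₀` and `q = m sinh t₀`, the phase `k cosh t - q sinh t`
is `m cosh (t - t₀)`. -/
lemma truncWave_eq_coshWave {k q : ℝ} (hk : |q| < k) (d : ℝ) : ∃ t₀ : ℝ, ∀ T : ℝ,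
    truncWave k d q T = (∫ u in (0 : ℝ)..(T - t₀), coshWave (d * √|k ^ 2 - q ^ 2|) u)
      + ∫ u in (0 : ℝ)..(T + t₀), coshWave (d * √|k ^ 2 - q ^ 2|) u := by
  have hkp : 0 < k := (abs_nonneg q).trans_lt hk
  have hpos : 0 < k ^ 2 - q ^ 2 := by
    have := sq_lt_sq' (by linarith [abs_nonneg q]) hk
    rw [sq_abs] at this
    linarith
  rw [abs_of_pos hpos]
  set m := √(k ^ 2 - q ^ 2) with hm
  have hm0 : 0 < m := Real.sqrt_pos.2 hpos
  have hm2 : m ^ 2 = k ^ 2 - q ^ 2 := Real.sq_sqrt hpos.le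
  have hs : m * Real.sinh (Real.arsinh (q / m)) = q := by rw [Real.sinh_arsinh]; field_simp
  have hc : m * Real.cosh (Real.arsinh (q / m)) = k := by
    rw [Real.cosh_arsinh, show (1 : ℝ) + (q / m) ^ 2 = (k / m) ^ 2 by field_simp; linarith,
      Real.sqrt_sq (by positivity)]
    field_simp
  refine ⟨Real.arsinh (q / m), fun T => ?_⟩
  set t₀ := Real.arsinh (q / m)
  have h1 : truncWave k d q T = ∫ t in (-T)..T, coshWave (d * m) ((t - t₀ : ℝ) : ℂ) := by
    refine intervalIntegral.integral_congr fun t _ => ?_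
    simp only [coshWave, ← Complex.ofReal_cosh, Real.cosh_sub, ← Complex.ofReal_mul]
    congr 3
    rw [← hs, ← hc]
    ring
  rw [h1, intervalIntegral.integral_comp_sub_right (fun u : ℝ => coshWave (d * m) u) t₀,
    ← intervalIntegral.integral_interval_sub_left (a := 0) (intervalIntegrable_coshWave _ _ _)
      (intervalIntegrable_coshWave _ _ _), show -T - t₀ = -(T + t₀) by ring,
    integral_coshWave_neg, sub_neg_eq_add]

/-- Now `k = m sinh t₀` and `q = m cosh t₀`, so the phase is `m sinh (t₀ - t)`. Negative `q` is
later reduced to this case by evenness. -/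
lemma truncWave_eq_sinhWave {k q : ℝ} (hk : 0 < k) (hq : k < q) (d : ℝ) : ∃ t₀ : ℝ, ∀ T : ℝ,
    truncWave k d q T = (∫ u in (0 : ℝ)..(T + t₀), sinhWave (d * √|k ^ 2 - q ^ 2|) u)
      + (starRingEnd ℂ) (∫ u in (0 : ℝ)..(T - t₀), sinhWave (d * √|k ^ 2 - q ^ 2|) u) := by
  have hpos : 0 < q ^ 2 - k ^ 2 := by nlinarith
  rw [abs_sub_comm, abs_of_pos hpos]
  set m := √(q ^ 2 - k ^ 2) with hm
  have hm0 : 0 < m := Real.sqrt_pos.2 hpos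
  have hm2 : m ^ 2 = q ^ 2 - k ^ 2 := Real.sq_sqrt hpos.le
  have hs : m * Real.sinh (Real.arsinh (k / m)) = k := by rw [Real.sinh_arsinh]; field_simp
  have hc : m * Real.cosh (Real.arsinh (k / m)) = q := by
    rw [Real.cosh_arsinh, show (1 : ℝ) + (k / m) ^ 2 = (q / m) ^ 2 by field_simp; linarith,
      Real.sqrt_sq (div_nonneg (hk.trans hq).le hm0.le)]
    field_simp
  refine ⟨Real.arsinh (k / m), fun T => ?_⟩
  set t₀ := Real.arsinh (k / m)
  have h1 : truncWave k d q T = ∫ t in (-T)..T, sinhWave (d * m) ((t₀ - t : ℝ) : ℂ) := by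
    refine intervalIntegral.integral_congr fun t _ => ?_
    simp only [sinhWave, ← Complex.ofReal_sinh, Real.sinh_sub, ← Complex.ofReal_mul]
    congr 3
    rw [← hs, ← hc]
    ring
  rw [h1, intervalIntegral.integral_comp_sub_left (fun u : ℝ => sinhWave (d * m) u) t₀,
    ← intervalIntegral.integral_interval_sub_left (a := 0) (intervalIntegrable_sinhWave _ _ _)
      (intervalIntegrable_sinhWave _ _ _), show t₀ - T = -(T - t₀) by ring,
    integral_sinhWave_neg, sub_neg_eq_add, sub_neg_eq_add, add_comm t₀ T]

lemma mul_sqrt_abs_pos {k d q : ℝ} (hd : 0 < d) (hk : 0 ≤ k) (hq : |q| ≠ k) :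
    0 < d * √|k ^ 2 - q ^ 2| := by
  have : k ^ 2 - q ^ 2 ≠ 0 := by
    intro h
    apply hq
    rw [← abs_of_nonneg hk, ← sq_eq_sq_iff_abs_eq_abs]
    linarith
  positivity

/-- The pointwise limit of `truncWave`. -/
def waveTransform (k d q : ℝ) : ℂ :=
  if |q| < k then
    ((Real.pi / 2 : ℝ) : ℂ) * Complex.I * (besselJ0 (d * √|k ^ 2 - q ^ 2|) : ℝ)
      - (Real.pi / 2 * besselY0 (d * √|k ^ 2 - q ^ 2|) : ℝ)
  else ((besselK 0 (d * √|k ^ 2 - q ^ 2|) : ℝ) : ℂ)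

lemma waveTransform_neg (k d q : ℝ) : waveTransform k d (-q) = waveTransform k d q := by
  simp [waveTransform]

lemma tendsto_truncWave {k d q : ℝ} (hk : 0 < k) (hd : 0 < d) (hq : |q| ≠ k) :
    Tendsto (truncWave k d q) atTop (𝓝 (2 * waveTransform k d q)) := by
  wlog h0 : 0 ≤ q generalizing q
  · have h := this (q := -q) (by rwa [abs_neg]) (by linarith)
    rw [waveTransform_neg] at h
    exact h.congr fun T => truncWave_neg k d q T
  have hy := mul_sqrt_abs_pos hd hk.le hq
  rw [waveTransform]
  split_ifs with h
  · obtain ⟨t₀, ht⟩ := truncWave_eq_coshWave h d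
    rw [← verticalSide_coshWave, two_mul]
    refine (((tendsto_integral_coshWave hy).comp (tendsto_atTop_add_const_right atTop (-t₀) tendsto_id)).add
      ((tendsto_integral_coshWave hy).comp (tendsto_atTop_add_const_right atTop t₀ tendsto_id))).congr fun T => ?_
    rw [ht T]
    simp [sub_eq_add_neg]
  · rw [abs_of_nonneg h0] at h hq
    obtain ⟨t₀, ht⟩ := truncWave_eq_sinhWave hk (lt_of_le_of_ne (not_lt.1 h) hq.symm) d
    have hl := (((tendsto_integral_sinhWave hy).comp (tendsto_atTop_add_const_right atTop t₀ tendsto_id)).add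
      ((Complex.continuous_conj.tendsto _).comp ((tendsto_integral_sinhWave hy).comp
        (tendsto_atTop_add_const_right atTop (-t₀) tendsto_id))))
    have he : ∀ v : ℂ, ∀ K : ℝ, v + (starRingEnd ℂ) v = 0 →
        v + K + (starRingEnd ℂ) (v + K) = 2 * K := by
      intro v K hv
      rw [map_add, Complex.conj_ofReal]
      linear_combination hv
    rw [he _ _ (verticalSide_sinhWave_add_conj _)] at hl
    refine hl.congr fun T => ?_
    rw [ht T]
    simp [sub_eq_add_neg]

/-- The two shifted half-line integrals are bounded independently of their endpoints, hence of `T`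
and of `t₀`. -/
lemma norm_truncWave_le {k d q : ℝ} (hk : 0 < k) (hd : 0 < d) (hq : |q| ≠ k) (T : ℝ) :
    ‖truncWave k d q T‖
      ≤ 2 * (Real.pi + Real.exp (d * k) * besselK 0 (d * √|k ^ 2 - q ^ 2|)) := by
  wlog h0 : 0 ≤ q generalizing q
  · have h := this (q := -q) (by rwa [abs_neg]) (by linarith)
    rwa [truncWave_neg, neg_sq] at h
  have hy := mul_sqrt_abs_pos hd hk.le hq
  rw [abs_of_nonneg h0] at hq
  have hK := besselK_zero_nonneg (d * √|k ^ 2 - q ^ 2|)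
  rcases lt_or_gt_of_ne hq with h | h
  · obtain ⟨t₀, ht⟩ := truncWave_eq_coshWave (by rwa [abs_of_nonneg h0]) d
    have hyk : d * √|k ^ 2 - q ^ 2| ≤ d * k := by
      gcongr
      rw [Real.sqrt_le_left hk.le, abs_of_nonneg (by nlinarith)]
      nlinarith
    have h1 := integral_exp_neg_mul_sinh_le hy
    have h2 : Real.exp (d * √|k ^ 2 - q ^ 2|) * besselK 0 (d * √|k ^ 2 - q ^ 2|)
      ≤ Real.exp (d * k) * besselK 0 (d * √|k ^ 2 - q ^ 2|) := by gcongr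
    rw [ht T]
    linarith [norm_add_le_of_le (norm_integral_coshWave_le_of_real hy (T - t₀))
      (norm_integral_coshWave_le_of_real hy (T + t₀))]
  · obtain ⟨t₀, ht⟩ := truncWave_eq_sinhWave hk h d
    have h2 : 1 * besselK 0 (d * √|k ^ 2 - q ^ 2|)
        ≤ Real.exp (d * k) * besselK 0 (d * √|k ^ 2 - q ^ 2|) := by
      gcongr
      exact Real.one_le_exp (by positivity)
    rw [ht T]
    have h3 := norm_integral_sinhWave_le_of_real hy (T - t₀)
    rw [← RCLike.norm_conj] at h3
    linarith [norm_add_le_of_le (norm_integral_sinhWave_le_of_real hy (T + t₀)) h3]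

/-- Since `m² = |q - k||q + k|`, the power `m^{-1/4}` is a product of two powers `-1/8`, which the
inequality between products and squares separates into singularities at `k` and `-k`. -/
lemma exists_norm_truncWave_le {k d : ℝ} (hk : 0 < k) (hd : 0 < d) : ∃ C : ℝ, 0 ≤ C ∧
    ∀ q T : ℝ, |q| ≠ k → ‖truncWave k d q T‖
      ≤ C * (1 + |q - k| ^ (-(1 / 4) : ℝ) + |q + k| ^ (-(1 / 4) : ℝ)) := by
  refine ⟨2 * Real.pi + 8 * Real.exp (d * k) * (d / 2) ^ (-(1 / 4) : ℝ), by positivity,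
    fun q T hq => (norm_truncWave_le hk hd hq T).trans ?_⟩
  have h1 := besselK_zero_le (mul_sqrt_abs_pos hd hk.le hq)
  have h2 : √|k ^ 2 - q ^ 2| ^ (-(1 / 4) : ℝ)
      ≤ |q - k| ^ (-(1 / 4) : ℝ) + |q + k| ^ (-(1 / 4) : ℝ) := by
    have h3 : √|k ^ 2 - q ^ 2| ^ (-(1 / 4) : ℝ)
        = |q - k| ^ (-(1 / 8) : ℝ) * |q + k| ^ (-(1 / 8) : ℝ) := by
      rw [Real.sqrt_eq_rpow, ← Real.rpow_mul (abs_nonneg _), abs_sub_comm,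
        show q ^ 2 - k ^ 2 = (q - k) * (q + k) by ring, abs_mul,
        Real.mul_rpow (abs_nonneg _) (abs_nonneg _)]
      norm_num
    have h4 : ∀ x : ℝ, 0 ≤ x → x ^ (-(1 / 4) : ℝ) = (x ^ (-(1 / 8) : ℝ)) ^ 2 := by
      intro x hx
      rw [← Real.rpow_natCast, ← Real.rpow_mul hx]
      norm_num
    rw [h3, h4 _ (abs_nonneg _), h4 _ (abs_nonneg _)]
    nlinarith [sq_nonneg (|q - k| ^ (-(1 / 8) : ℝ) - |q + k| ^ (-(1 / 8) : ℝ)),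
      sq_nonneg (|q - k| ^ (-(1 / 8) : ℝ)), sq_nonneg (|q + k| ^ (-(1 / 8) : ℝ))]
  rw [mul_div_right_comm, Real.mul_rpow (by positivity) (by positivity)] at h1
  set X := |q - k| ^ (-(1 / 4) : ℝ) + |q + k| ^ (-(1 / 4) : ℝ) with hX
  have hX0 : 0 ≤ X := by positivity
  set D := (d / 2) ^ (-(1 / 4) : ℝ)
  have hD : 0 ≤ D := by positivity
  have h5 : besselK 0 (d * √|k ^ 2 - q ^ 2|) ≤ 4 * (D * X) :=
    h1.trans (by gcongr)
  have h6 : Real.exp (d * k) * besselK 0 (d * √|k ^ 2 - q ^ 2|)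
      ≤ Real.exp (d * k) * (4 * (D * X)) := by gcongr
  have h7 : 0 ≤ Real.pi * X := by positivity
  have h8 : 0 ≤ Real.exp (d * k) * D := by positivity
  rw [add_assoc, ← hX]
  nlinarith

/-! ### Inverse transforms of the four building blocks of `F2` -/

lemma integral_eq_Ioi_add_Ioi {f : ℝ → ℂ} (hf : Integrable f) :
    ∫ q, f q = (∫ q in Set.Ioi (0 : ℝ), f q) + ∫ q in Set.Ioi (0 : ℝ), f (-q) := by
  rw [integral_comp_neg_Ioi, neg_zero, add_comm,
    intervalIntegral.integral_Iic_add_Ioi hf.integrableOn hf.integrableOn]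

lemma integrable_exp_neg_mul_abs {c : ℝ} (hc : 0 < c) :
    Integrable fun q : ℝ => Real.exp (-c * |q|) := by
  have h := integrable_abs_rpow_mul_exp (s := 0) zero_lt_one le_rfl hc 0 0
  simpa using h

lemma mul_exp_neg_le {c v : ℝ} (hc : 0 < c) :
    v * Real.exp (-c * v) ≤ 2 / c * Real.exp (-(c / 2) * v) := by
  have h1 := Real.add_one_le_exp (c / 2 * v)
  have h2 : Real.exp (-c * v) = Real.exp (-(c / 2) * v) * Real.exp (-(c / 2 * v)) := by
    rw [← Real.exp_add]; congr 1; ring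
  have h3 : v * Real.exp (-(c / 2 * v)) ≤ 2 / c := by
    rw [Real.exp_neg, ← div_eq_mul_inv, div_le_div_iff₀ (Real.exp_pos _) hc]
    nlinarith
  rw [h2]
  nlinarith [Real.exp_pos (-(c / 2) * v)]

lemma integrable_abs_mul_exp {c : ℝ} (hc : 0 < c) :
    Integrable fun q : ℝ => |q| * Real.exp (-c * |q|) := by
  refine Integrable.mono' ((integrable_exp_neg_mul_abs (half_pos hc)).const_mul (2 / c))
    (by fun_prop) (Eventually.of_forall fun q => ?_)
  rw [Real.norm_of_nonneg (by positivity)]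
  exact mul_exp_neg_le hc

lemma norm_exp_I_mul (x : ℝ) : ‖Complex.exp (Complex.I * x)‖ = 1 := by
  rw [mul_comm]; exact Complex.norm_exp_ofReal_mul_I x

lemma integrable_ofReal_mul_exp_I {w : ℝ → ℝ} (hw : Integrable w) (x : ℝ) :
    Integrable fun q : ℝ => (w q : ℂ) * Complex.exp (Complex.I * (q * x : ℝ)) :=
  hw.ofReal.mul_bdd (c := 1) (by fun_prop)
    (Eventually.of_forall fun q => (norm_exp_I_mul _).le)

lemma ofReal_sub_I_mul_ne_zero {c : ℝ} (hc : 0 < c) (x : ℝ) : (c : ℂ) - Complex.I * x ≠ 0 := by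
  intro h
  have := congrArg Complex.re h
  simp at this
  exact hc.ne' this

lemma inverse_transform_exp {c : ℝ} (hc : 0 < c) (x : ℝ) :
    ∫ q : ℝ, ((Real.exp (-c * |q|) : ℝ) : ℂ) * Complex.exp (Complex.I * (q * x : ℝ))
      = (2 * c / (c ^ 2 + x ^ 2) : ℝ) := by
  have key : ∀ x : ℝ, ∫ q in Set.Ioi (0 : ℝ), ((Real.exp (-c * |q|) : ℝ) : ℂ)
      * Complex.exp (Complex.I * (q * x : ℝ)) = 1 / ((c : ℂ) - Complex.I * x) := by
    intro x
    have h := integral_exp_mul_complex_Ioi (a := -((c : ℂ) - Complex.I * x)) (by simpa using hc) 0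
    rw [show 1 / ((c : ℂ) - Complex.I * x) = -Complex.exp (-((c : ℂ) - Complex.I * x) * (0 : ℝ))
      / (-((c : ℂ) - Complex.I * x)) by
        rw [Complex.ofReal_zero, mul_zero, Complex.exp_zero, neg_div_neg_eq], ← h]
    refine setIntegral_congr_fun measurableSet_Ioi fun q hq => ?_
    simp only [abs_of_pos (Set.mem_Ioi.1 hq), Complex.ofReal_exp, ← Complex.exp_add]
    congr 1
    push_cast
    ring
  rw [integral_eq_Ioi_add_Ioi (integrable_ofReal_mul_exp_I (integrable_exp_neg_mul_abs hc) x)]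
  have h2 := key (-x)
  simp only [abs_neg, ← neg_mul_comm _ x] at h2 ⊢
  rw [key x, h2]
  have h3 := ofReal_sub_I_mul_ne_zero hc x
  have h4 := ofReal_sub_I_mul_ne_zero hc (-x)
  have h5 : ((c : ℂ) ^ 2 + x ^ 2) = (c - Complex.I * x) * (c + Complex.I * x) := by
    linear_combination ((x : ℂ) ^ 2) * Complex.I_mul_I
  rw [Complex.ofReal_neg, mul_neg, sub_neg_eq_add] at h4 ⊢
  push_cast
  rw [h5]
  field_simp
  ring

lemma integral_mul_exp_neg_mul_Ioi {a : ℂ} (ha : 0 < a.re) :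
    ∫ q in Set.Ioi (0 : ℝ), (q : ℂ) * Complex.exp (-a * q) = 1 / a ^ 2 := by
  have ha0 : a ≠ 0 := by
    rintro rfl
    simp at ha
  have hn : ∀ q : ℝ, ‖(q : ℂ) * Complex.exp (-a * q)‖ = |q| * Real.exp (-a.re * q) := fun q => by
    rw [norm_mul, Complex.norm_real, Complex.norm_exp]
    simp
  have he : Tendsto (fun q : ℝ => Real.exp (-(a.re / 2) * q)) atTop (𝓝 0) :=
    Real.tendsto_exp_atBot.comp (tendsto_id.const_mul_atTop_of_neg (by linarith))
  have hexp : Tendsto (fun q : ℝ => Complex.exp (-a * q)) atTop (𝓝 0) := by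
    refine squeeze_zero_norm' (a := fun q : ℝ => Real.exp (-(a.re / 2) * q)) ?_ he
    filter_upwards [eventually_ge_atTop 0] with q hq
    rw [Complex.norm_exp]
    apply Real.exp_le_exp.2
    simp
    nlinarith
  have hmul : Tendsto (fun q : ℝ => (q : ℂ) * Complex.exp (-a * q)) atTop (𝓝 0) := by
    refine squeeze_zero_norm' (a := fun q : ℝ => 2 / a.re * Real.exp (-(a.re / 2) * q)) ?_
      (by simpa using he.const_mul (2 / a.re))
    filter_upwards [eventually_ge_atTop 0] with q hq
    rw [hn, abs_of_nonneg hq]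
    exact mul_exp_neg_le ha
  have h := integral_Ioi_of_hasDerivAt_of_tendsto' (a := 0)
    -- The antiderivative from integration by parts.
    (f := fun q : ℝ => -(1 / a) * ((q : ℂ) * Complex.exp (-a * q)) - 1 / a ^ 2 * Complex.exp (-a * q))
    (f' := fun q : ℝ => (q : ℂ) * Complex.exp (-a * q))
    (m := -(1 / a) * 0 - 1 / a ^ 2 * 0) (fun q _ => ?_) ?_
    ((hmul.const_mul _).sub (hexp.const_mul _))
  · rw [h]
    simp
  · have h1 : HasDerivAt (fun q : ℝ => (q : ℂ)) 1 q := Complex.ofRealCLM.hasDerivAt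
    have h2 := (h1.const_mul (-a)).cexp
    refine (((h1.mul h2).const_mul (-(1 / a))).sub (h2.const_mul (1 / a ^ 2))).congr_deriv ?_
    field_simp
    ring
  · refine Integrable.mono' (integrable_abs_mul_exp ha).integrableOn (by fun_prop)
      ((ae_restrict_iff' measurableSet_Ioi).2 (Eventually.of_forall fun q hq => ?_))
    rw [hn]
    simp only [abs_of_pos (Set.mem_Ioi.1 hq), le_refl]

lemma inverse_transform_abs_mul_exp {c : ℝ} (hc : 0 < c) (x : ℝ) :
    ∫ q : ℝ, ((|q| * Real.exp (-c * |q|) : ℝ) : ℂ) * Complex.exp (Complex.I * (q * x : ℝ))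
      = (2 * (c ^ 2 - x ^ 2) / (c ^ 2 + x ^ 2) ^ 2 : ℝ) := by
  have key : ∀ x : ℝ, ∫ q in Set.Ioi (0 : ℝ), ((|q| * Real.exp (-c * |q|) : ℝ) : ℂ)
      * Complex.exp (Complex.I * (q * x : ℝ)) = 1 / ((c : ℂ) - Complex.I * x) ^ 2 := by
    intro x
    have h := integral_mul_exp_neg_mul_Ioi (a := (c : ℂ) - Complex.I * x) (by simpa using hc)
    rw [← h]
    refine setIntegral_congr_fun measurableSet_Ioi fun q hq => ?_
    simp only [abs_of_pos (Set.mem_Ioi.1 hq)]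
    push_cast
    rw [mul_assoc, ← Complex.exp_add]
    congr 2
    ring
  rw [integral_eq_Ioi_add_Ioi (integrable_ofReal_mul_exp_I (integrable_abs_mul_exp hc) x)]
  have h2 := key (-x)
  simp only [abs_neg, ← neg_mul_comm _ x] at h2 ⊢
  rw [key x, h2]
  have h3 := ofReal_sub_I_mul_ne_zero hc x
  have h4 := ofReal_sub_I_mul_ne_zero hc (-x)
  have h5 : ((c : ℂ) ^ 2 + x ^ 2) = (c - Complex.I * x) * (c + Complex.I * x) := by
    linear_combination ((x : ℂ) ^ 2) * Complex.I_mul_I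
  rw [Complex.ofReal_neg, mul_neg, sub_neg_eq_add] at h4 ⊢
  push_cast
  rw [h5]
  field_simp
  linear_combination (2 * (x : ℂ) ^ 2) * Complex.I_mul_I

lemma integral_exp_neg_mul_abs {c : ℝ} (hc : 0 < c) :
    ∫ q : ℝ, Real.exp (-c * |q|) = 2 / c := by
  have h := inverse_transform_exp hc 0
  simp only [mul_zero, Complex.ofReal_zero, Complex.exp_zero, mul_one] at h
  rw [integral_complex_ofReal] at h
  rw [Complex.ofReal_inj.1 h]
  field_simp
  ring

lemma integral_abs_mul_exp {c : ℝ} (hc : 0 < c) :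
    ∫ q : ℝ, |q| * Real.exp (-c * |q|) = 2 / c ^ 2 := by
  have h := inverse_transform_abs_mul_exp hc 0
  simp only [mul_zero, Complex.ofReal_zero, Complex.exp_zero, mul_one] at h
  rw [integral_complex_ofReal] at h
  rw [Complex.ofReal_inj.1 h]
  field_simp
  ring

lemma integrable_inv_cosh : IntegrableOn (fun t : ℝ => (Real.cosh t)⁻¹) (Set.Ioi 0) := by
  refine Integrable.mono' ((integrableOn_exp_mul_Ioi (by norm_num : (-1 : ℝ) < 0) 0).const_mul 2)
    (by apply Measurable.aestronglyMeasurable; fun_prop) (Eventually.of_forall fun t => ?_)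
  rw [Real.norm_of_nonneg (inv_nonneg.2 (Real.cosh_pos t).le), neg_one_mul, Real.exp_neg,
    ← div_eq_mul_inv, ← inv_div]
  exact inv_anti₀ (by positivity) (exp_half_le_cosh t)

/-- Integrating in `q` first leaves `2/(d cosh t)`, which is integrable. With the extra weight `|q|
cosh t` below, what is left is `2/(d² cosh t)`. -/
lemma integrable_prod_exp {d : ℝ} (hd : 0 < d) :
    Integrable (fun z : ℝ × ℝ => Real.exp (-(d * |z.1|) * Real.cosh z.2))
      (volume.prod (volume.restrict (Set.Ioi 0))) := by
  have he : ∀ q t : ℝ, Real.exp (-(d * |q|) * Real.cosh t) = Real.exp (-(d * Real.cosh t) * |q|) :=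
    fun q t => by congr 1; ring
  rw [integrable_prod_iff' (by fun_prop)]
  refine ⟨Eventually.of_forall fun t => ?_, ?_⟩
  · simp only [he]
    exact integrable_exp_neg_mul_abs (mul_pos hd (Real.cosh_pos t))
  · refine (integrable_inv_cosh.const_mul (2 / d)).congr (Eventually.of_forall fun t => ?_)
    simp only [he, Real.norm_of_nonneg (Real.exp_pos _).le]
    rw [integral_exp_neg_mul_abs (mul_pos hd (Real.cosh_pos t))]
    have := Real.cosh_pos t
    field_simp

lemma integrable_prod_abs_mul_exp {d : ℝ} (hd : 0 < d) :
    Integrable (fun z : ℝ × ℝ => |z.1| * (Real.exp (-(d * |z.1|) * Real.cosh z.2)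
      * Real.cosh (1 * z.2))) (volume.prod (volume.restrict (Set.Ioi 0))) := by
  have he : ∀ q t : ℝ, |q| * (Real.exp (-(d * |q|) * Real.cosh t) * Real.cosh (1 * t))
      = Real.cosh t * (|q| * Real.exp (-(d * Real.cosh t) * |q|)) :=
    fun q t => by rw [one_mul, show -(d * |q|) * Real.cosh t = -(d * Real.cosh t) * |q| by ring]; ring
  rw [integrable_prod_iff' (by fun_prop)]
  refine ⟨Eventually.of_forall fun t => ?_, ?_⟩
  · simp only [he]
    exact (integrable_abs_mul_exp (mul_pos hd (Real.cosh_pos t))).const_mul _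
  · refine (integrable_inv_cosh.const_mul (2 / d ^ 2)).congr (Eventually.of_forall fun t => ?_)
    have := Real.cosh_pos t
    have h0 : ∀ q : ℝ, 0 ≤ Real.cosh t * (|q| * Real.exp (-(d * Real.cosh t) * |q|)) :=
      fun q => by positivity
    simp only [he, Real.norm_of_nonneg (h0 _)]
    rw [integral_const_mul, integral_abs_mul_exp (mul_pos hd (Real.cosh_pos t))]
    field_simp

lemma integrable_besselK_zero {d : ℝ} (hd : 0 < d) :
    Integrable fun q : ℝ => besselK 0 (d * |q|) := by
  simp only [besselK_zero_eq]
  exact (integrable_prod_exp hd).integral_prod_left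

lemma integrable_abs_mul_besselK_one {d : ℝ} (hd : 0 < d) :
    Integrable fun q : ℝ => |q| * besselK 1 (d * |q|) := by
  simp only [besselK, ← integral_const_mul]
  exact (integrable_prod_abs_mul_exp hd).integral_prod_left

/-- Fubini for the inverse Fourier transform of a real parametric integral. -/
lemma inverse_transform_integral {f : ℝ × ℝ → ℝ} {ν : Measure ℝ} [SFinite ν]
    (hf : Integrable f (volume.prod ν)) (x : ℝ) :
    ∫ q : ℝ, ((∫ t, f (q, t) ∂ν : ℝ) : ℂ) * Complex.exp (Complex.I * (q * x : ℝ))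
      = ∫ t, (∫ q : ℝ, (f (q, t) : ℂ) * Complex.exp (Complex.I * (q * x : ℝ))) ∂ν := by
  have h : Integrable (fun z : ℝ × ℝ => (f z : ℂ) * Complex.exp (Complex.I * (z.1 * x : ℝ)))
      (volume.prod ν) :=
    hf.ofReal.mul_bdd (c := 1) (by fun_prop) (Eventually.of_forall fun q => (norm_exp_I_mul _).le)
  refine Eq.trans ?_ (integral_integral_swap (f := fun q t => (f (q, t) : ℂ)
    * Complex.exp (Complex.I * (q * x : ℝ))) h)
  refine integral_congr_ae (Eventually.of_forall fun q => ?_)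
  simp only
  rw [← integral_complex_ofReal, integral_mul_const]

lemma hasDerivAt_arctan_sinh {d r : ℝ} (hr : 0 < r) (t : ℝ) :
    HasDerivAt (fun t => Real.arctan (d * Real.sinh t / r))
      (d * Real.cosh t * r / (r ^ 2 + (d * Real.sinh t) ^ 2)) t := by
  refine ((((Real.hasDerivAt_sinh t).const_mul d).div_const r).arctan).congr_deriv ?_
  field_simp

lemma tendsto_arctan_sinh {d r : ℝ} (hd : 0 < d) (hr : 0 < r) :
    Tendsto (fun t => Real.arctan (d * Real.sinh t / r)) atTop (𝓝 (Real.pi / 2)) :=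
  (Real.tendsto_arctan_atTop.mono_right nhdsWithin_le_nhds).comp
    ((tendsto_sinh_atTop.const_mul_atTop hd).atTop_div_const hr)

lemma mul_cosh_sq (d x t : ℝ) :
    (d * Real.cosh t) ^ 2 + x ^ 2 = (x ^ 2 + d ^ 2) + (d * Real.sinh t) ^ 2 := by
  rw [mul_pow, Real.cosh_sq]; ring

/-- With `s = d sinh t` the integrand becomes `2 ds/(r² + s²)`. -/
lemma integral_cosh_div {d : ℝ} (hd : 0 < d) (x : ℝ) :
    ∫ t in Set.Ioi (0 : ℝ), 2 * (d * Real.cosh t) / ((d * Real.cosh t) ^ 2 + x ^ 2)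
      = Real.pi / √(x ^ 2 + d ^ 2) := by
  have hr : 0 < √(x ^ 2 + d ^ 2) := by positivity
  have hr2 : √(x ^ 2 + d ^ 2) ^ 2 = x ^ 2 + d ^ 2 := Real.sq_sqrt (by positivity)
  set r := √(x ^ 2 + d ^ 2)
  have h := integral_Ioi_of_hasDerivAt_of_nonneg' (a := 0)
    (g := fun t => 2 / r * Real.arctan (d * Real.sinh t / r))
    (g' := fun t => 2 * (d * Real.cosh t) / ((d * Real.cosh t) ^ 2 + x ^ 2))
    (l := 2 / r * (Real.pi / 2)) (fun t _ => ?_) (fun t _ => ?_)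
    ((tendsto_arctan_sinh hd hr).const_mul _)
  · rw [h]
    simp
  · refine ((hasDerivAt_arctan_sinh hr t).const_mul (2 / r)).congr_deriv ?_
    rw [mul_cosh_sq, ← hr2]
    field_simp
  · have := Real.cosh_pos t
    positivity

lemma integral_cosh_mul_div {d : ℝ} (hd : 0 < d) (x : ℝ) :
    ∫ t in Set.Ioi (0 : ℝ), Real.cosh t * (2 * ((d * Real.cosh t) ^ 2 - x ^ 2)
        / ((d * Real.cosh t) ^ 2 + x ^ 2) ^ 2)
      = Real.pi * d / √(x ^ 2 + d ^ 2) ^ 3 := by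
  have hr : 0 < √(x ^ 2 + d ^ 2) := by positivity
  have hr2 : √(x ^ 2 + d ^ 2) ^ 2 = x ^ 2 + d ^ 2 := Real.sq_sqrt (by positivity)
  set r := √(x ^ 2 + d ^ 2)
  have hden : ∀ t : ℝ, 0 < r ^ 2 + (d * Real.sinh t) ^ 2 := fun t => by positivity
  have hlim : Tendsto (fun t => d * Real.sinh t / (r ^ 2 + (d * Real.sinh t) ^ 2)) atTop (𝓝 0) := by
    have hv : Tendsto (fun t => d * Real.sinh t) atTop atTop :=
      tendsto_sinh_atTop.const_mul_atTop hd
    refine squeeze_zero' (g := fun t => 1 / (d * Real.sinh t)) ?_ ?_ (hv.const_div_atTop 1)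
    · filter_upwards [hv.eventually_gt_atTop 0] with t ht
      exact div_nonneg ht.le (hden t).le
    · filter_upwards [hv.eventually_gt_atTop 0] with t ht
      rw [div_le_div_iff₀ (hden t) ht]
      nlinarith
  have h := integral_Ioi_of_hasDerivAt_of_tendsto' (a := 0)
    -- With `s = d sinh t`, the numerator `d² + s² - x²` equals `(r² + s²) - 2x²`; integrating the
    -- two fractions and using `r² - x² = d²` gives this primitive. The integrand may change sign,
    -- so its integrability is checked separately.
    (f := fun t => 2 * d / r ^ 3 * Real.arctan (d * Real.sinh t / r)
      - 2 * x ^ 2 / (d * r ^ 2) * (d * Real.sinh t / (r ^ 2 + (d * Real.sinh t) ^ 2)))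
    (f' := fun t => Real.cosh t * (2 * ((d * Real.cosh t) ^ 2 - x ^ 2)
        / ((d * Real.cosh t) ^ 2 + x ^ 2) ^ 2))
    (m := 2 * d / r ^ 3 * (Real.pi / 2) - 2 * x ^ 2 / (d * r ^ 2) * 0) (fun t _ => ?_) ?_
    (((tendsto_arctan_sinh hd hr).const_mul _).sub (hlim.const_mul _))
  · rw [h]
    simp
    field_simp
  · have h1 := ((Real.hasDerivAt_sinh t).const_mul d)
    have h2 := h1.div ((h1.pow 2).const_add (r ^ 2)) (hden t).ne'
    refine (((hasDerivAt_arctan_sinh hr t).const_mul (2 * d / r ^ 3)).sub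
      (h2.const_mul (2 * x ^ 2 / (d * r ^ 2)))).congr_deriv ?_
    have h3 := (hden t).ne'
    have h4 : (d * Real.cosh t) ^ 2 = d ^ 2 + (d * Real.sinh t) ^ 2 := by
      rw [mul_pow, Real.cosh_sq]; ring
    have h5 : x ^ 2 = r ^ 2 - d ^ 2 := by linarith
    simp only [Pi.pow_apply]
    rw [mul_cosh_sq, ← hr2, h4, h5]
    field_simp
    ring
  · refine Integrable.mono' (integrable_inv_cosh.const_mul (2 / d ^ 2))
      (by apply Measurable.aestronglyMeasurable; fun_prop) (Eventually.of_forall fun t => ?_)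
    have hc := Real.cosh_pos t
    have hp : 0 < (d * Real.cosh t) ^ 2 := by positivity
    rw [norm_mul, Real.norm_of_nonneg hc.le, norm_div, Real.norm_eq_abs, Real.norm_eq_abs,
      abs_of_pos (show 0 < ((d * Real.cosh t) ^ 2 + x ^ 2) ^ 2 by positivity), abs_mul, abs_two]
    have h1 : |(d * Real.cosh t) ^ 2 - x ^ 2| ≤ (d * Real.cosh t) ^ 2 + x ^ 2 := by
      rw [abs_le]; constructor <;> nlinarith [sq_nonneg x]
    calc Real.cosh t * (2 * |(d * Real.cosh t) ^ 2 - x ^ 2| / ((d * Real.cosh t) ^ 2 + x ^ 2) ^ 2)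
        ≤ Real.cosh t * (2 * ((d * Real.cosh t) ^ 2 + x ^ 2)
          / ((d * Real.cosh t) ^ 2 + x ^ 2) ^ 2) := by gcongr
      _ = Real.cosh t * (2 / ((d * Real.cosh t) ^ 2 + x ^ 2)) := by
        have : (d * Real.cosh t) ^ 2 + x ^ 2 ≠ 0 := by positivity
        field_simp
      _ ≤ Real.cosh t * (2 / (d * Real.cosh t) ^ 2) := by
        gcongr
        nlinarith [sq_nonneg x]
      _ = 2 / d ^ 2 * (Real.cosh t)⁻¹ := by field_simp

/-- `K₀(d|q|)` is a superposition of `e^{-c|q|}` with `c = d cosh t`, so Fubini reduces to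
`inverse_transform_exp`. The `K₁` case is the same with `inverse_transform_abs_mul_exp`. -/
lemma inverse_transform_besselK_zero {d : ℝ} (hd : 0 < d) (x : ℝ) :
    ∫ q : ℝ, ((besselK 0 (d * |q|) : ℝ) : ℂ) * Complex.exp (Complex.I * (q * x : ℝ))
      = (Real.pi / √(x ^ 2 + d ^ 2) : ℝ) := by
  simp only [besselK_zero_eq]
  rw [inverse_transform_integral (integrable_prod_exp hd) x, ← integral_cosh_div hd x]
  refine Eq.trans (integral_congr_ae (Eventually.of_forall fun t => ?_)) integral_complex_ofReal
  simp only
  rw [← inverse_transform_exp (mul_pos hd (Real.cosh_pos t)) x]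
  refine integral_congr_ae (Eventually.of_forall fun q => ?_)
  simp only
  rw [show -(d * |q|) * Real.cosh t = -(d * Real.cosh t) * |q| by ring]

lemma inverse_transform_abs_mul_besselK_one {d : ℝ} (hd : 0 < d) (x : ℝ) :
    ∫ q : ℝ, ((|q| * besselK 1 (d * |q|) : ℝ) : ℂ) * Complex.exp (Complex.I * (q * x : ℝ))
      = (Real.pi * d / √(x ^ 2 + d ^ 2) ^ 3 : ℝ) := by
  simp only [besselK, ← integral_const_mul]
  rw [inverse_transform_integral (integrable_prod_abs_mul_exp hd) x, ← integral_cosh_mul_div hd x]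
  refine Eq.trans (integral_congr_ae (Eventually.of_forall fun t => ?_)) integral_complex_ofReal
  simp only
  rw [Complex.ofReal_mul, ← inverse_transform_abs_mul_exp (mul_pos hd (Real.cosh_pos t)) x,
    ← integral_const_mul]
  refine integral_congr_ae (Eventually.of_forall fun q => ?_)
  simp only
  rw [show -(d * |q|) * Real.cosh t = -(d * Real.cosh t) * |q| by ring, one_mul]
  push_cast
  ring_nf

/-! ### The factor `F2`: its transform and its size -/

lemma sqrt_pi_div_two : √(Real.pi / 2) = √(2 * Real.pi) / 2 := by
  rw [show Real.pi / 2 = 2 * Real.pi / 2 ^ 2 by ring, Real.sqrt_div' _ (by positivity),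
    Real.sqrt_sq (by norm_num)]

lemma sqrt_two_div_pi : √(2 / Real.pi) = √(2 * Real.pi) / Real.pi := by
  have := Real.pi_pos
  rw [show 2 / Real.pi = 2 * Real.pi / Real.pi ^ 2 by field_simp, Real.sqrt_div' _ (by positivity),
    Real.sqrt_sq this.le]

/-- Like terms are collected and `√(2π)` is pulled out, so that `F2` is a combination of four
functions with known inverse transforms. -/
lemma F2_eq {lam d : ℝ} (hd : 0 < d) (q : ℝ) :
    F2 lam d q = ((√(2 * Real.pi) : ℝ) : ℂ) *
      (((d / 2 + (lam / (2 * Real.pi)) ^ 2 / (4 * d) : ℝ) : ℂ) * (Real.exp (-d * |q|) : ℝ)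
      + ((-(3 / 4) * (lam / (2 * Real.pi)) ^ 2 : ℝ) : ℂ) * (|q| * Real.exp (-d * |q|) : ℝ)
      + Complex.I * ((-(lam / Real.pi ^ 2) : ℝ) : ℂ) * (besselK 0 (d * |q|) : ℝ)
      + Complex.I * ((3 * d * lam / (2 * Real.pi ^ 2) : ℝ) : ℂ) * (|q| * besselK 1 (d * |q|) : ℝ))
      := by
  have hpi : (Real.pi : ℂ) ≠ 0 := by exact_mod_cast Real.pi_ne_zero
  have hd' : (d : ℂ) ≠ 0 := by exact_mod_cast hd.ne'
  rw [F2, sqrt_pi_div_two, sqrt_two_div_pi, abs_mul, abs_of_pos hd, neg_mul_eq_neg_mul]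
  push_cast
  field_simp
  ring

lemma integrable_F2 {lam d : ℝ} (hd : 0 < d) : Integrable (F2 lam d) := by
  have h := ((((integrable_exp_neg_mul_abs hd).ofReal (𝕜 := ℂ)).const_mul
      ((d / 2 + (lam / (2 * Real.pi)) ^ 2 / (4 * d) : ℝ) : ℂ)).add
    (((integrable_abs_mul_exp hd).ofReal (𝕜 := ℂ)).const_mul
      ((-(3 / 4) * (lam / (2 * Real.pi)) ^ 2 : ℝ) : ℂ))).add
    (((integrable_besselK_zero hd).ofReal (𝕜 := ℂ)).const_mul
      (Complex.I * ((-(lam / Real.pi ^ 2) : ℝ) : ℂ))) |>.add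
    (((integrable_abs_mul_besselK_one hd).ofReal (𝕜 := ℂ)).const_mul
      (Complex.I * ((3 * d * lam / (2 * Real.pi ^ 2) : ℝ) : ℂ)))
  exact (h.const_mul ((√(2 * Real.pi) : ℝ) : ℂ)).congr
    (Eventually.of_forall fun q => (F2_eq hd q).symm)

/-- The bracket in the Green function. -/
def greenBracket (lam d x : ℝ) : ℂ :=
  ((d ^ 2 / (x ^ 2 + d ^ 2) : ℝ) : ℂ)
      + Complex.I / (2 * Real.pi * √(x ^ 2 + d ^ 2) / lam : ℝ)
          * ((d ^ 2 - 2 * x ^ 2) / (x ^ 2 + d ^ 2) : ℝ)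
      - 1 / ((2 * Real.pi / lam) ^ 2 * (x ^ 2 + d ^ 2) : ℝ)
          * ((d ^ 2 - 2 * x ^ 2) / (x ^ 2 + d ^ 2) : ℝ)

lemma integral_add_four {f₁ f₂ f₃ f₄ : ℝ → ℂ} (h₁ : Integrable f₁) (h₂ : Integrable f₂)
    (h₃ : Integrable f₃) (h₄ : Integrable f₄) :
    ∫ q, (f₁ q + f₂ q + f₃ q + f₄ q)
      = (∫ q, f₁ q) + (∫ q, f₂ q) + (∫ q, f₃ q) + ∫ q, f₄ q := by
  have h₁₂ : Integrable fun q => f₁ q + f₂ q := h₁.add h₂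
  have h₁₃ : Integrable fun q => f₁ q + f₂ q + f₃ q := h₁₂.add h₃
  rw [integral_add h₁₃ h₄, integral_add h₁₂ h₃, integral_add h₁ h₂]

lemma inverse_transform_F2 {lam d : ℝ} (hlam : 0 < lam) (hd : 0 < d) (x : ℝ) :
    ∫ q : ℝ, F2 lam d q * Complex.exp (Complex.I * (q * x : ℝ))
      = ((√(2 * Real.pi) : ℝ) : ℂ) * greenBracket lam d x := by
  have hpi : (Real.pi : ℂ) ≠ 0 := by exact_mod_cast Real.pi_ne_zero
  have hd' : (d : ℂ) ≠ 0 := by exact_mod_cast hd.ne'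
  have hl' : (lam : ℂ) ≠ 0 := by exact_mod_cast hlam.ne'
  have hr : 0 < √(x ^ 2 + d ^ 2) := by positivity
  have hr2 : √(x ^ 2 + d ^ 2) ^ 2 = x ^ 2 + d ^ 2 := Real.sq_sqrt (by positivity)
  have h1 := (integrable_ofReal_mul_exp_I (integrable_exp_neg_mul_abs hd) x).const_mul
      ((d / 2 + (lam / (2 * Real.pi)) ^ 2 / (4 * d) : ℝ) : ℂ)
  have h2 := (integrable_ofReal_mul_exp_I (integrable_abs_mul_exp hd) x).const_mul
      ((-(3 / 4) * (lam / (2 * Real.pi)) ^ 2 : ℝ) : ℂ)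
  have h3 := (integrable_ofReal_mul_exp_I (integrable_besselK_zero hd) x).const_mul
      (Complex.I * ((-(lam / Real.pi ^ 2) : ℝ) : ℂ))
  have h4 := (integrable_ofReal_mul_exp_I (integrable_abs_mul_besselK_one hd) x).const_mul
      (Complex.I * ((3 * d * lam / (2 * Real.pi ^ 2) : ℝ) : ℂ))
  have e : ∀ q : ℝ, F2 lam d q * Complex.exp (Complex.I * (q * x : ℝ)) =
      ((√(2 * Real.pi) : ℝ) : ℂ) *
      (((d / 2 + (lam / (2 * Real.pi)) ^ 2 / (4 * d) : ℝ) : ℂ) * ((Real.exp (-d * |q|) : ℝ)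
        * Complex.exp (Complex.I * (q * x : ℝ)))
      + ((-(3 / 4) * (lam / (2 * Real.pi)) ^ 2 : ℝ) : ℂ) * ((|q| * Real.exp (-d * |q|) : ℝ)
        * Complex.exp (Complex.I * (q * x : ℝ)))
      + Complex.I * ((-(lam / Real.pi ^ 2) : ℝ) : ℂ) * ((besselK 0 (d * |q|) : ℝ)
        * Complex.exp (Complex.I * (q * x : ℝ)))
      + Complex.I * ((3 * d * lam / (2 * Real.pi ^ 2) : ℝ) : ℂ) * ((|q| * besselK 1 (d * |q|) : ℝ)
        * Complex.exp (Complex.I * (q * x : ℝ)))) := fun q => by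
    rw [F2_eq hd]; ring
  simp only [e]
  rw [integral_const_mul, integral_add_four h1 h2 h3 h4, integral_const_mul, integral_const_mul, integral_const_mul,
    integral_const_mul, inverse_transform_exp hd, inverse_transform_abs_mul_exp hd,
    inverse_transform_besselK_zero hd, inverse_transform_abs_mul_besselK_one hd, greenBracket,
    add_comm (d ^ 2) (x ^ 2)]
  set r := √(x ^ 2 + d ^ 2)
  rw [← hr2]
  have hr' : (r : ℂ) ≠ 0 := by exact_mod_cast hr.ne'
  rw [show x ^ 2 = r ^ 2 - d ^ 2 by linarith]
  congr 1
  push_cast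
  field_simp
  ring

lemma exists_norm_F2_le {lam d : ℝ} (hd : 0 < d) : ∃ C : ℝ, 0 ≤ C ∧ ∀ q : ℝ, q ≠ 0 →
    ‖F2 lam d q‖ ≤ C * ((1 + |q| ^ (-(1 / 4) : ℝ)) * Real.exp (-(d / 4) * |q|)) := by
  -- Needed for `D = d` and for `D = d/2`, the latter because `K₁` is bounded by `K₀` at half the
  -- argument; hence the common rate `d/4`.
  have hK : ∀ D : ℝ, 0 < D → d / 4 ≤ D / 2 → ∀ q : ℝ, q ≠ 0 → besselK 0 (D * |q|)
      ≤ 4 * (D / 4) ^ (-(1 / 4) : ℝ) * (|q| ^ (-(1 / 4) : ℝ) * Real.exp (-(d / 4) * |q|)) := by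
    intro D hD hDd q hq
    have hq' : 0 < |q| := abs_pos.2 hq
    have hy : 0 < D * |q| := by positivity
    have h1 := (besselK_zero_le_exp_mul hy).trans
      (mul_le_mul_of_nonneg_left (besselK_zero_le (half_pos hy)) (Real.exp_pos _).le)
    rw [show D * |q| / 2 / 2 = D / 4 * |q| by ring,
      Real.mul_rpow (by positivity) hq'.le] at h1
    have h2 : Real.exp (-(D * |q| / 2)) ≤ Real.exp (-(d / 4) * |q|) :=
      Real.exp_le_exp.2 (by nlinarith)
    refine h1.trans ((mul_le_mul_of_nonneg_right h2 (by positivity)).trans_eq (by ring))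
  set a₁ := ‖((d / 2 + (lam / (2 * Real.pi)) ^ 2 / (4 * d) : ℝ) : ℂ)‖ with ha₁
  set a₂ := ‖((-(3 / 4) * (lam / (2 * Real.pi)) ^ 2 : ℝ) : ℂ)‖ with ha₂
  set a₃ := ‖Complex.I * ((-(lam / Real.pi ^ 2) : ℝ) : ℂ)‖ with ha₃
  set a₄ := ‖Complex.I * ((3 * d * lam / (2 * Real.pi ^ 2) : ℝ) : ℂ)‖ with ha₄
  set s := ‖((√(2 * Real.pi) : ℝ) : ℂ)‖ with hs
  set b₃ := 4 * (d / 4) ^ (-(1 / 4) : ℝ) with hb₃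
  set b₄ := 4 * (d / 2 / 4) ^ (-(1 / 4) : ℝ) with hb₄
  refine ⟨s * (a₁ + a₂ * (2 / d) + a₃ * b₃ + a₄ * (2 / d * b₄)), by positivity, fun q hq => ?_⟩
  have hq' : 0 < |q| := abs_pos.2 hq
  set u := |q| ^ (-(1 / 4) : ℝ) with hu
  set v := Real.exp (-(d / 4) * |q|) with hv
  have hu0 : 0 ≤ u := by positivity
  have hv0 : 0 < v := by positivity
  have e1 : Real.exp (-d * |q|) ≤ (1 + u) * v := by
    have : Real.exp (-d * |q|) ≤ v := Real.exp_le_exp.2 (by nlinarith)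
    nlinarith
  have e2 : |q| * Real.exp (-d * |q|) ≤ 2 / d * ((1 + u) * v) := by
    refine (mul_exp_neg_le hd).trans ?_
    gcongr
    have : Real.exp (-(d / 2) * |q|) ≤ v := Real.exp_le_exp.2 (by nlinarith)
    nlinarith
  have e3 : besselK 0 (d * |q|) ≤ b₃ * ((1 + u) * v) := by
    refine (hK d hd (by linarith) q hq).trans ?_
    gcongr
    linarith
  have e4 : |q| * besselK 1 (d * |q|) ≤ 2 / d * b₄ * ((1 + u) * v) := by
    have h1 := besselK_one_le (mul_pos hd hq')
    have h2 := hK (d / 2) (by positivity) (by linarith) q hq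
    rw [mul_div_right_comm] at h1
    calc |q| * besselK 1 (d * |q|) ≤ |q| * (2 / (d * |q|) * besselK 0 (d / 2 * |q|)) := by gcongr
      _ = 2 / d * besselK 0 (d / 2 * |q|) := by field_simp
      _ ≤ 2 / d * (b₄ * (u * v)) := by gcongr
      _ ≤ 2 / d * (b₄ * ((1 + u) * v)) := by gcongr; linarith
      _ = _ := by ring
  have n : ∀ x : ℝ, 0 ≤ x → ‖(x : ℂ)‖ = x := fun x hx => by
    rw [Complex.norm_real, Real.norm_of_nonneg hx]
  rw [F2_eq hd, norm_mul, mul_assoc s]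
  refine mul_le_mul_of_nonneg_left ?_ (norm_nonneg _)
  refine (norm_add_le_of_le (norm_add_le_of_le (norm_add_le_of_le
    (norm_mul_le_of_le le_rfl ((n _ (by positivity)).le.trans e1))
    (norm_mul_le_of_le le_rfl ((n _ (by positivity)).le.trans e2)))
    (norm_mul_le_of_le le_rfl ((n _ (besselK_zero_nonneg _)).le.trans e3)))
    (norm_mul_le_of_le le_rfl ((n _ (mul_nonneg hq'.le (besselK_one_nonneg _))).le.trans e4))).trans_eq ?_
  rw [← ha₁, ← ha₂, ← ha₃, ← ha₄]
  ring

/-- The dominating function of the convolution integrand. -/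
def convBound (k c κ q : ℝ) : ℝ :=
  (1 + |q - k| ^ (-(1 / 4) : ℝ) + |q + k| ^ (-(1 / 4) : ℝ))
    * ((1 + |κ - q| ^ (-(1 / 4) : ℝ)) * Real.exp (-c * |κ - q|))

lemma measurable_convBound (k c κ : ℝ) : Measurable (convBound k c κ) := by
  unfold convBound
  have h : ∀ a : ℝ, Measurable fun q : ℝ => |q + a| ^ (-(1 / 4) : ℝ) := fun a =>
    (measurable_id.add_const a).abs.pow_const _
  have h' : Measurable fun q : ℝ => |κ - q| ^ (-(1 / 4) : ℝ) :=
    (measurable_id.const_sub κ).abs.pow_const _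
  simp only [sub_eq_add_neg _ k]
  exact (((measurable_const.add (h _)).add (h _))).mul ((measurable_const.add h').mul (by fun_prop))

/-- The singularity at `κ` may coincide with one at `±k`, so the products are bounded by sums of
squares, whose exponent `-1/2` is still integrable. -/
lemma integrable_convBound {c : ℝ} (hc : 0 < c) (k κ : ℝ) : Integrable (convBound k c κ) := by
  have h : ∀ a : ℝ, Integrable fun q : ℝ => |q - a| ^ (-(1 / 2) : ℝ) * Real.exp (-c * |κ - q|) :=
    fun a => integrable_abs_rpow_mul_exp (by norm_num) (by norm_num) hc a κ
  have h0 : Integrable fun q : ℝ => Real.exp (-c * |κ - q|) :=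
    (integrable_exp_neg_mul_abs hc).comp_sub_left κ
  refine Integrable.mono' (((h0.add (h κ)).add ((h k).add (h (-k)))).const_mul 3)
    (measurable_convBound k c κ).aestronglyMeasurable (Eventually.of_forall fun q => ?_)
  have h4 : ∀ x : ℝ, |x| ^ (-(1 / 2) : ℝ) = (|x| ^ (-(1 / 4) : ℝ)) ^ 2 := by
    intro x
    rw [← Real.rpow_natCast, ← Real.rpow_mul (abs_nonneg x)]
    norm_num
  rw [Real.norm_of_nonneg (by unfold convBound; positivity)]
  simp only [Pi.add_apply, h4, sub_neg_eq_add]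
  rw [abs_sub_comm q κ, convBound]
  set E := Real.exp (-c * |κ - q|)
  have hE : 0 < E := Real.exp_pos _
  set u := |κ - q| ^ (-(1 / 4) : ℝ)
  set v := |q - k| ^ (-(1 / 4) : ℝ)
  set w := |q + k| ^ (-(1 / 4) : ℝ)
  have key : (1 + v + w) * (1 + u) ≤ 3 * (1 + u ^ 2 + (v ^ 2 + w ^ 2)) := by
    nlinarith [sq_nonneg (u - v), sq_nonneg (u - w), sq_nonneg (u - 1), sq_nonneg (v - 1),
      sq_nonneg (w - 1), sq_nonneg u, sq_nonneg v, sq_nonneg w]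
  calc (1 + v + w) * ((1 + u) * E) = (1 + v + w) * (1 + u) * E := by ring
    _ ≤ 3 * (1 + u ^ 2 + (v ^ 2 + w ^ 2)) * E := by gcongr
    _ = _ := by ring

/-! ### Integrability of the Green function -/

lemma green_eq (Z₀ lam d x : ℝ) :
    green Z₀ lam d x = (-Complex.I * Z₀ * Complex.exp (Complex.I *
      (2 * Real.pi * √(x ^ 2 + d ^ 2) / lam : ℝ))) / (2 * lam * √(x ^ 2 + d ^ 2) : ℝ)
        * greenBracket lam d x := rfl

/-- Every term is `O(1/r)` because `d ≤ r`; with the prefactor `1/r`, the Green function is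
`O(1/r²)`. -/
lemma norm_greenBracket_le {lam d : ℝ} (hlam : 0 < lam) (hd : 0 < d) (x : ℝ) :
    ‖greenBracket lam d x‖
      ≤ (d + lam / Real.pi + lam ^ 2 / (2 * Real.pi ^ 2 * d)) / √(x ^ 2 + d ^ 2) := by
  have hr : 0 < √(x ^ 2 + d ^ 2) := by positivity
  have hr2 : √(x ^ 2 + d ^ 2) ^ 2 = x ^ 2 + d ^ 2 := Real.sq_sqrt (by positivity)
  have hdr : d ≤ √(x ^ 2 + d ^ 2) := Real.le_sqrt_of_sq_le (by nlinarith [sq_nonneg x])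
  have hpi := Real.pi_pos
  have hD : ‖(((d ^ 2 - 2 * x ^ 2) / (x ^ 2 + d ^ 2) : ℝ) : ℂ)‖ ≤ 2 := by
    rw [Complex.norm_real, norm_div, Real.norm_eq_abs, Real.norm_eq_abs,
      abs_of_pos (show 0 < x ^ 2 + d ^ 2 by positivity), div_le_iff₀ (by positivity), abs_le]
    constructor <;> nlinarith [sq_nonneg x, sq_nonneg d]
  rw [greenBracket]
  set r := √(x ^ 2 + d ^ 2)
  refine (norm_sub_le_of_le (norm_add_le_of_le
    (r₁ := d / r) (r₂ := lam / Real.pi / r) ?_ ?_)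
    (r₂ := lam ^ 2 / (2 * Real.pi ^ 2 * d) / r) ?_).trans_eq (by ring)
  · rw [Complex.norm_real, Real.norm_of_nonneg (by positivity), ← hr2, div_le_div_iff₀ (by positivity) hr]
    nlinarith [mul_nonneg (mul_nonneg hd.le hr.le) (sub_nonneg.2 hdr)]
  · refine (norm_mul_le_of_le (r₁ := lam / (2 * Real.pi * r)) ?_ hD).trans_eq ?_
    · rw [norm_div, Complex.norm_I, Complex.norm_real, Real.norm_of_nonneg (by positivity),
        one_div_div]
    · field_simp
  · refine (norm_mul_le_of_le (r₁ := lam ^ 2 / (4 * Real.pi ^ 2 * (d * r))) ?_ hD).trans_eq ?_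
    · rw [norm_div, norm_one, Complex.norm_real, Real.norm_of_nonneg (by positivity), ← hr2,
        show (2 * Real.pi / lam) ^ 2 * r ^ 2
          = 4 * Real.pi ^ 2 * (r * r) / lam ^ 2 by ring, one_div_div]
      gcongr
    · field_simp
      norm_num

lemma continuous_green {lam d : ℝ} (Z₀ : ℝ) (hlam : 0 < lam) (hd : 0 < d) :
    Continuous (green Z₀ lam d) := by
  have h1 : ∀ x : ℝ, x ^ 2 + d ^ 2 ≠ 0 := fun x => by positivity
  have h2 : ∀ x : ℝ, ((2 * lam * √(x ^ 2 + d ^ 2) : ℝ) : ℂ) ≠ 0 := fun x => by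
    have : 2 * lam * √(x ^ 2 + d ^ 2) ≠ 0 := by positivity
    exact_mod_cast this
  have h3 : ∀ x : ℝ, ((2 * Real.pi * √(x ^ 2 + d ^ 2) / lam : ℝ) : ℂ) ≠ 0 := fun x => by
    have : 2 * Real.pi * √(x ^ 2 + d ^ 2) / lam ≠ 0 := by positivity
    exact_mod_cast this
  have h4 : ∀ x : ℝ, (((2 * Real.pi / lam) ^ 2 * (x ^ 2 + d ^ 2) : ℝ) : ℂ) ≠ 0 := fun x => by
    have : (2 * Real.pi / lam) ^ 2 * (x ^ 2 + d ^ 2) ≠ 0 := by positivity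
    exact_mod_cast this
  have hb : Continuous fun x : ℝ => (((d ^ 2 - 2 * x ^ 2) / (x ^ 2 + d ^ 2) : ℝ) : ℂ) :=
    Complex.continuous_ofReal.comp (Continuous.div (by fun_prop) (by fun_prop) h1)
  have ha : Continuous fun x : ℝ => ((d ^ 2 / (x ^ 2 + d ^ 2) : ℝ) : ℂ) :=
    Complex.continuous_ofReal.comp (Continuous.div (by fun_prop) (by fun_prop) h1)
  unfold green
  exact (Continuous.div (by fun_prop) (by fun_prop) h2).mul
    ((ha.add ((Continuous.div (by fun_prop) (by fun_prop) h3).mul hb)).sub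
      ((Continuous.div (by fun_prop) (by fun_prop) h4).mul hb))

lemma integrable_green {lam d : ℝ} (Z₀ : ℝ) (hlam : 0 < lam) (hd : 0 < d) :
    Integrable (green Z₀ lam d) := by
  have hpi := Real.pi_pos
  set M := d + lam / Real.pi + lam ^ 2 / (2 * Real.pi ^ 2 * d) with hM
  have hM0 : 0 < M := by positivity
  refine Integrable.mono' (integrable_inv_one_add_sq.const_mul (|Z₀| * M / (2 * lam) * (1 + (d ^ 2)⁻¹)))
    (continuous_green Z₀ hlam hd).aestronglyMeasurable (Eventually.of_forall fun x => ?_)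
  have hr : 0 < √(x ^ 2 + d ^ 2) := by positivity
  have hr2 : √(x ^ 2 + d ^ 2) ^ 2 = x ^ 2 + d ^ 2 := Real.sq_sqrt (by positivity)
  have h1 : (x ^ 2 + d ^ 2)⁻¹ ≤ (1 + (d ^ 2)⁻¹) * (1 + x ^ 2)⁻¹ := by
    rw [← div_eq_mul_inv, inv_eq_one_div, div_le_div_iff₀ (by positivity) (by positivity)]
    have : (d ^ 2)⁻¹ * d ^ 2 = 1 := inv_mul_cancel₀ (by positivity)
    have : 0 ≤ (d ^ 2)⁻¹ * x ^ 2 := by positivity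
    nlinarith [sq_nonneg d]
  rw [green_eq, norm_mul, norm_div, norm_mul, norm_exp_I_mul, mul_one, norm_mul, norm_neg,
    Complex.norm_I, one_mul, Complex.norm_real, Complex.norm_real, Real.norm_eq_abs,
    Real.norm_of_nonneg (by positivity)]
  have hb := norm_greenBracket_le hlam hd x
  rw [← hM] at hb
  set r := √(x ^ 2 + d ^ 2)
  calc |Z₀| / (2 * lam * r) * ‖greenBracket lam d x‖
      ≤ |Z₀| / (2 * lam * r) * (M / r) := by gcongr
    _ = |Z₀| * M / (2 * lam) * (x ^ 2 + d ^ 2)⁻¹ := by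
        rw [← hr2]
        field_simp
    _ ≤ |Z₀| * M / (2 * lam) * ((1 + (d ^ 2)⁻¹) * (1 + x ^ 2)⁻¹) := by gcongr
    _ = _ := by ring

/-! ### Fubini for the cut-off integral and passage to the limit -/

/-- The scalar spherical wave `exp (j k r) / r` with `r = √(x² + d²)`. -/
def sphericalWave (k d x : ℝ) : ℂ :=
  Complex.exp (Complex.I * (k * √(x ^ 2 + d ^ 2) : ℝ)) / (√(x ^ 2 + d ^ 2) : ℝ)

lemma continuous_sphericalWave (k : ℝ) {d : ℝ} (hd : 0 < d) : Continuous (sphericalWave k d) := by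
  refine Continuous.div (by fun_prop) (by fun_prop) fun x => ?_
  have : √(x ^ 2 + d ^ 2) ≠ 0 := by positivity
  exact_mod_cast this

/-- For `x = d sinh t` one has `r = d cosh t`, so `dx/r = dt`. -/
lemma integral_sphericalWave {d : ℝ} (hd : 0 < d) (k q T : ℝ) :
    ∫ x in (-(d * Real.sinh T))..(d * Real.sinh T),
        sphericalWave k d x * Complex.exp (-Complex.I * (q * x : ℝ))
      = truncWave k d q T := by
  have h := intervalIntegral.integral_deriv_smul_comp (a := -T) (b := T)
    (f := fun t => d * Real.sinh t) (f' := fun t => d * Real.cosh t)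
    (g := fun x : ℝ => sphericalWave k d x * Complex.exp (-Complex.I * (q * x : ℝ)))
    (fun t _ => (Real.hasDerivAt_sinh t).const_mul d) (by fun_prop)
    ((continuous_sphericalWave k hd).mul (by fun_prop))
  simp only [Real.sinh_neg, mul_neg] at h
  rw [← h, truncWave]
  refine intervalIntegral.integral_congr fun t _ => ?_
  have hc := Real.cosh_pos t
  have hr : √((d * Real.sinh t) ^ 2 + d ^ 2) = d * Real.cosh t := by
    rw [show (d * Real.sinh t) ^ 2 + d ^ 2 = (d * Real.cosh t) ^ 2 by
      rw [mul_pow, mul_pow, Real.cosh_sq]; ring, Real.sqrt_sq (by positivity)]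
  have hne : ((d * Real.cosh t : ℝ) : ℂ) ≠ 0 := by
    have : d * Real.cosh t ≠ 0 := by positivity
    exact_mod_cast this
  simp only [Function.comp_apply, sphericalWave, hr, Complex.real_smul]
  rw [div_mul_eq_mul_div, mul_div_cancel₀ _ hne, ← Complex.exp_add]
  congr 1
  push_cast
  ring

lemma continuous_truncWave (k d T : ℝ) : Continuous fun q => truncWave k d q T := by
  unfold truncWave
  exact intervalIntegral.continuous_parametric_intervalIntegral_of_continuous' (by fun_prop) _ _

lemma inverse_transform_F2_shift {lam d : ℝ} (hlam : 0 < lam) (hd : 0 < d) (κ x : ℝ) :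
    ∫ q : ℝ, F2 lam d (κ - q) * Complex.exp (-Complex.I * (q * x : ℝ))
      = ((√(2 * Real.pi) : ℝ) : ℂ) * greenBracket lam d x
        * Complex.exp (-Complex.I * (κ * x : ℝ)) := by
  rw [← inverse_transform_F2 hlam hd, ← integral_mul_const,
    ← integral_sub_left_eq_self (fun q : ℝ => F2 lam d q * Complex.exp (Complex.I * (q * x : ℝ))
      * Complex.exp (-Complex.I * (κ * x : ℝ))) volume κ]
  refine integral_congr_ae (Eventually.of_forall fun q => ?_)
  simp only
  rw [mul_assoc, ← Complex.exp_add]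
  congr 2
  push_cast
  ring

/-- The bracket is written as the inverse transform of `F2`, shifted by `κ`. On the bounded interval
the wave is integrable, so Fubini applies, which it would not on the whole line. -/
lemma truncated_transform_eq {lam d : ℝ} (Z₀ : ℝ) (hlam : 0 < lam) (hd : 0 < d) (κ : ℝ) {T : ℝ}
    (hT : 0 ≤ T) :
    ∫ x in (-(d * Real.sinh T))..(d * Real.sinh T),
        green Z₀ lam d x * Complex.exp (-Complex.I * (κ * x : ℝ))
      = -Complex.I * Z₀ / (2 * lam * √(2 * Real.pi) : ℝ)
        * ∫ q, truncWave (2 * Real.pi / lam) d q T * F2 lam d (κ - q) := by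
  set k := 2 * Real.pi / lam with hk
  set X := d * Real.sinh T with hX
  have hX0 : 0 ≤ X := mul_nonneg hd.le (Real.sinh_nonneg_iff.2 hT)
  have hint : Integrable (Function.uncurry fun x q : ℝ => sphericalWave k d x
      * (F2 lam d (κ - q) * Complex.exp (-Complex.I * (q * x : ℝ))))
      ((volume.restrict (Set.Ioc (-X) X)).prod volume) := by
    have h1 : Integrable (sphericalWave k d) (volume.restrict (Set.Ioc (-X) X)) :=
      (continuous_sphericalWave k hd).integrableOn_Ioc
    have h2 : Integrable fun q => F2 lam d (κ - q) := (integrable_F2 hd).comp_sub_left κ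
    refine ((h1.mul_prod h2).mul_bdd (c := 1)
      (g := fun z : ℝ × ℝ => Complex.exp (-Complex.I * (z.2 * z.1 : ℝ))) (by fun_prop)
      (Eventually.of_forall fun z => ?_)).congr (Eventually.of_forall fun z => ?_)
    · rw [neg_mul, ← mul_neg, ← Complex.ofReal_neg, norm_exp_I_mul]
    · simp only [Function.uncurry, mul_assoc]
  have hs : ((√(2 * Real.pi) : ℝ) : ℂ) ≠ 0 := by
    have : √(2 * Real.pi) ≠ 0 := by have := Real.pi_pos; positivity
    exact_mod_cast this
  have hl : (lam : ℂ) ≠ 0 := by exact_mod_cast hlam.ne'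
  have hg : ∀ x : ℝ, green Z₀ lam d x * Complex.exp (-Complex.I * (κ * x : ℝ))
      = -Complex.I * Z₀ / (2 * lam * √(2 * Real.pi) : ℝ) * ∫ q : ℝ, sphericalWave k d x
        * (F2 lam d (κ - q) * Complex.exp (-Complex.I * (q * x : ℝ))) := by
    intro x
    have hr : ((√(x ^ 2 + d ^ 2) : ℝ) : ℂ) ≠ 0 := by
      have : √(x ^ 2 + d ^ 2) ≠ 0 := by positivity
      exact_mod_cast this
    rw [integral_const_mul, inverse_transform_F2_shift hlam hd, green_eq, sphericalWave, hk,
      show 2 * Real.pi / lam * √(x ^ 2 + d ^ 2) = 2 * Real.pi * √(x ^ 2 + d ^ 2) / lam by ring]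
    generalize Complex.exp _ = E₁
    generalize Complex.exp _ = E₂
    rw [Complex.ofReal_mul (2 * lam), Complex.ofReal_mul (2 * lam)]
    push_cast
    field_simp
  simp only [hg]
  rw [intervalIntegral.integral_const_mul, intervalIntegral.integral_of_le (by linarith),
    integral_integral_swap hint]
  congr 1
  refine integral_congr_ae (Eventually.of_forall fun q => ?_)
  simp only
  rw [← integral_sphericalWave hd, ← hX, intervalIntegral.integral_of_le (by linarith),
    ← integral_mul_const]
  refine integral_congr_ae (Eventually.of_forall fun x => ?_)
  simp only
  ring

lemma ae_abs_ne {k : ℝ} : ∀ᵐ q : ℝ, |q| ≠ k := by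
  have h : ({k, -k} : Set ℝ).Countable := (Set.countable_singleton _).insert _
  filter_upwards [h.ae_notMem volume] with q hq hk
  rcases eq_or_eq_neg_of_abs_eq hk with h | h <;> exact hq (by simp [h])

lemma ae_sub_ne_zero (κ : ℝ) : ∀ᵐ q : ℝ, κ - q ≠ 0 := by
  filter_upwards [(Set.countable_singleton κ).ae_notMem volume] with q hq h
  exact hq (by simp; linarith)

lemma F1_eq (Z₀ lam d q : ℝ) : F1 Z₀ lam d q
    = -Complex.I * Z₀ / (2 * Real.pi * lam : ℝ) * waveTransform (2 * Real.pi / lam) d q := rfl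

lemma convolution_dominated {lam d : ℝ} (hlam : 0 < lam) (hd : 0 < d) (κ : ℝ) :
    ∃ bound : ℝ → ℝ, Integrable bound ∧ ∀ T : ℝ, ∀ᵐ q : ℝ,
      ‖truncWave (2 * Real.pi / lam) d q T * F2 lam d (κ - q)‖ ≤ bound q := by
  have hk : 0 < 2 * Real.pi / lam := by have := Real.pi_pos; positivity
  obtain ⟨C₁, hC₁, h₁⟩ := exists_norm_truncWave_le hk hd
  obtain ⟨C₂, hC₂, h₂⟩ := exists_norm_F2_le (lam := lam) hd
  refine ⟨fun q => C₁ * C₂ * convBound (2 * Real.pi / lam) (d / 4) κ q,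
    (integrable_convBound (by positivity) _ κ).const_mul _, fun T => ?_⟩
  filter_upwards [ae_abs_ne (k := 2 * Real.pi / lam), ae_sub_ne_zero κ] with q hq hκ
  refine (norm_mul_le_of_le (h₁ q T hq) (h₂ _ hκ)).trans_eq ?_
  rw [convBound]
  ring

lemma tendsto_mul_F2 {lam d : ℝ} (hlam : 0 < lam) (hd : 0 < d) (κ : ℝ) :
    ∀ᵐ q : ℝ, Tendsto (fun T => truncWave (2 * Real.pi / lam) d q T * F2 lam d (κ - q)) atTop
      (𝓝 (2 * waveTransform (2 * Real.pi / lam) d q * F2 lam d (κ - q))) := by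
  have hk : 0 < 2 * Real.pi / lam := by have := Real.pi_pos; positivity
  filter_upwards [ae_abs_ne (k := 2 * Real.pi / lam)] with q hq
  exact (tendsto_truncWave hk hd hq).mul_const _

lemma aestronglyMeasurable_truncWave_mul_F2 {lam d : ℝ} (hd : 0 < d) (κ T : ℝ) :
    AEStronglyMeasurable fun q => truncWave (2 * Real.pi / lam) d q T * F2 lam d (κ - q) :=
  (continuous_truncWave _ _ _).aestronglyMeasurable.mul
    ((integrable_F2 hd).comp_sub_left κ).aestronglyMeasurable

/-- The limit inherits the bound, and its measurability comes from being an a.e. limit along the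
integers, so none has to be proved for the Bessel functions in `waveTransform`. -/
lemma integrable_waveTransform_mul_F2 {lam d : ℝ} (hlam : 0 < lam) (hd : 0 < d) (κ : ℝ) :
    Integrable fun q => 2 * waveTransform (2 * Real.pi / lam) d q * F2 lam d (κ - q) := by
  obtain ⟨bound, hb, hle⟩ := convolution_dominated hlam hd κ
  refine Integrable.mono' hb (aestronglyMeasurable_of_tendsto_ae atTop
    (fun n : ℕ => aestronglyMeasurable_truncWave_mul_F2 (lam := lam) hd κ n) ?_) ?_
  · filter_upwards [tendsto_mul_F2 hlam hd κ] with q hq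
    exact hq.comp tendsto_natCast_atTop_atTop
  · filter_upwards [tendsto_mul_F2 hlam hd κ, ae_all_iff.2 fun n : ℕ => hle n] with q hq hn
    exact le_of_tendsto (hq.comp tendsto_natCast_atTop_atTop).norm (Eventually.of_forall hn)

/-- Both sides are limits of the same cut-off integral: the left because the Green function is
integrable, the right by dominated convergence. -/
lemma integral_green_mul_exp {lam d : ℝ} (Z₀ : ℝ) (hlam : 0 < lam) (hd : 0 < d) (κ : ℝ) :
    ∫ x : ℝ, green Z₀ lam d x * Complex.exp (-Complex.I * (κ * x : ℝ))
      = -Complex.I * Z₀ / (2 * lam * √(2 * Real.pi) : ℝ)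
        * ∫ q, 2 * waveTransform (2 * Real.pi / lam) d q * F2 lam d (κ - q) := by
  obtain ⟨bound, hb, hle⟩ := convolution_dominated hlam hd κ
  have hX : Tendsto (fun T => d * Real.sinh T) atTop atTop :=
    tendsto_sinh_atTop.const_mul_atTop hd
  have hgi : Integrable fun x : ℝ => green Z₀ lam d x * Complex.exp (-Complex.I * (κ * x : ℝ)) := by
    refine (integrable_green Z₀ hlam hd).mul_bdd (c := 1) (by fun_prop)
      (Eventually.of_forall fun x => ?_)
    rw [neg_mul, ← mul_neg, ← Complex.ofReal_neg, norm_exp_I_mul]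
  have hlim := intervalIntegral_tendsto_integral hgi (tendsto_neg_atTop_atBot.comp hX) hX
  refine tendsto_nhds_unique hlim (Tendsto.congr' ?_ (Tendsto.const_mul _
    (tendsto_integral_filter_of_dominated_convergence bound
      (Eventually.of_forall (aestronglyMeasurable_truncWave_mul_F2 hd κ))
      (Eventually.of_forall hle) hb (tendsto_mul_F2 hlam hd κ))))
  filter_upwards [eventually_ge_atTop 0] with T hT
  exact (truncated_transform_eq Z₀ hlam hd κ hT).symm

end ParallelLines

end

theorem lemma1 (Z₀ lam d : ℝ) (hlam : 0 < lam) (hd : 0 < d) :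
    Integrable (ParallelLines.green Z₀ lam d) ∧
    ∀ κ : ℝ,
      ConvolutionExistsAt (ParallelLines.F1 Z₀ lam d) (ParallelLines.F2 lam d) κ
        (ContinuousLinearMap.mul ℂ ℂ) volume ∧
      ParallelLines.fourierU (ParallelLines.green Z₀ lam d) κ =
        convolution (ParallelLines.F1 Z₀ lam d) (ParallelLines.F2 lam d)
          (ContinuousLinearMap.mul ℂ ℂ) volume κ := by
  have hs : ((√(2 * Real.pi) : ℝ) : ℂ) ≠ 0 := by
    have : √(2 * Real.pi) ≠ 0 := by have := Real.pi_pos; positivity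
    exact_mod_cast this
  have hs2 : ((√(2 * Real.pi) : ℝ) : ℂ) ^ 2 = 2 * Real.pi := by
    have : √(2 * Real.pi) ^ 2 = 2 * Real.pi := Real.sq_sqrt (by have := Real.pi_pos; positivity)
    exact_mod_cast this
  have hl : (lam : ℂ) ≠ 0 := by exact_mod_cast hlam.ne'
  have hpi : (Real.pi : ℂ) ≠ 0 := by exact_mod_cast Real.pi_ne_zero
  refine ⟨ParallelLines.integrable_green Z₀ hlam hd, fun κ => ?_⟩
  -- The constant `4πλ` is `√(2π) · 2λ√(2π)`, the normalisation of the Fourier transform times the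
  -- constant of `integral_green_mul_exp`.
  have hF : ∀ q : ℝ, ContinuousLinearMap.mul ℂ ℂ (ParallelLines.F1 Z₀ lam d q)
      (ParallelLines.F2 lam d (κ - q)) = -Complex.I * Z₀ / (4 * Real.pi * lam : ℝ)
        * (2 * ParallelLines.waveTransform (2 * Real.pi / lam) d q
          * ParallelLines.F2 lam d (κ - q)) := by
    intro q
    rw [ContinuousLinearMap.mul_apply', ParallelLines.F1_eq]
    push_cast
    field_simp
    ring
  refine ⟨?_, ?_⟩
  · rw [ConvolutionExistsAt]
    simp only [hF]
    exact (ParallelLines.integrable_waveTransform_mul_F2 hlam hd κ).const_mul _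
  · rw [convolution, ParallelLines.fourierU, ParallelLines.integral_green_mul_exp Z₀ hlam hd]
    simp only [hF]
    rw [integral_const_mul, ← mul_assoc]
    congr 1
    push_cast
    field_simp
    rw [hs2]
    ring
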